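/- Let $S$ be a finite set of at least $5$ points in the plane in general position, i.e. with no three points on a common line, and let $u\in S$. Consider the plane spanning paths on $S$ that have $u$ as an endpoint: the graphs on the vertex set $S$ that are paths through all points of $S$ with $u$ as one of the two ends, such that, when every edge is drawn as the straight line segment between its two points, distinct edges meet at most in a common endpoint. Let $G_{\mathcal P}^u(S)$ be the graph whose vertices are these paths, two distinct paths with edge sets $E_1,E_2$ being adjacent if they differ by a flip, i.e. $E_2=(E_1\setminus\{e\})\cup\{f\}$ for some edges $e,f$. Then $G_{\mathcal P}^u(S)$ has no connected component on at most $4$ vertices. -/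

import Mathlib

/-- The Euclidean plane. -/
abbrev Plane : Type := EuclideanSpace ℝ (Fin 2)

/-- A finite point set is in general position if no three distinct points of it are collinear. -/
def InGeneralPosition (S : Finset Plane) : Prop :=
  ∀ a ∈ S, ∀ b ∈ S, ∀ c ∈ S, a ≠ b → a ≠ c → b ≠ c → ¬ Collinear ℝ ({a, b, c} : Set Plane)

/-- A straight-line drawing of a graph on the point set `S` (the edge `ab` is drawn as the segment
from `a` to `b`) is plane if distinct edges meet at most in a common endpoint. -/
def IsPlaneDrawing {S : Finset Plane} (G : SimpleGraph S) : Prop :=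
  ∀ a b c d : S, G.Adj a b → G.Adj c d → s(a, b) ≠ s(c, d) →
    segment ℝ (a : Plane) b ∩ segment ℝ (c : Plane) d ⊆
      ({(a : Plane), (b : Plane)} ∩ {(c : Plane), (d : Plane)} : Set Plane)

/-- `G` is a spanning path on `S` with `u` as one of its two endpoints: some walk from `u` visits
every point exactly once and uses every edge of `G`. -/
def IsSpanningPathFrom {S : Finset Plane} (u : S) (G : SimpleGraph S) : Prop :=
  ∃ (v : S) (p : G.Walk u v), p.IsHamiltonian ∧ ∀ e ∈ G.edgeSet, e ∈ p.edges

/-- The plane spanning paths on `S` with fixed endpoint `u`. -/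
abbrev PlaneSpanningPathFrom (S : Finset Plane) (u : S) : Type :=
  {G : SimpleGraph S // IsSpanningPathFrom u G ∧ IsPlaneDrawing G}

/-- A flip exchanges one edge for another: `E₂ = (E₁ \ {e}) ∪ {f}`. -/
def IsFlip {V : Type*} (G₁ G₂ : SimpleGraph V) : Prop :=
  ∃ e ∈ G₁.edgeSet, ∃ f ∈ G₂.edgeSet, G₂.edgeSet = (G₁.edgeSet \ {e}) ∪ {f}

/-- The flip graph of plane spanning paths on `S` with fixed endpoint `u`: two distinct such paths
are adjacent if one is obtained from the other by a flip. -/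
def fixedEndpointFlipGraph (S : Finset Plane) (u : S) : SimpleGraph (PlaneSpanningPathFrom S u) :=
  SimpleGraph.fromRel fun P Q => IsFlip P.1 Q.1

/-! Write a path as a list `p, a, b, …, u` from its free end to `u`. If no edge crosses the segment
from `p` to a point `c` other than `a`, with `q` just before `c`, then exchanging `qc` for `pc` is a
flip, and it reverses the part of the list before `c`. Only these flips are used: they are enough to
bound a component from below. Reversals of distinct prefixes, of length at least 2, form no
triangles and no quadrilaterals.

Visibility supplies the flips (`exists_sees_of_not_sees`): if `p` does not see `r`, it sees a point
strictly on each side of the direction of `r`. Hence every path has a flip. If it has only one, then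
`ab` is what hides all further points from `p`, and the flip reverses the prefix `p, a`
(`eq_two_of_seesAt_unique`).

If every path in the component has two flips, two steps in two directions from any path give five
distinct paths. Otherwise start from a path `p, a, b, x, …` with a single flip. Its neighbour `a, p,
b, x, …` has another flip, because four points have at most one crossing pair of opposite segments.
If the neighbour has at least three flips, it and three of its neighbours, together with a further
path behind one of them, make five. If it has exactly two, the second leads to `b, p, a, x, …`,
which has three flips by the same crossing argument and takes over as the centre. -/

/-! ### Signed areas and crossing segments -/

/-- Twice the signed area of the triangle `p a b`. -/
def cr (p a b : Plane) : ℝ := (a 0 - p 0) * (b 1 - p 1) - (a 1 - p 1) * (b 0 - p 0)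

theorem cr_swap (p a b : Plane) : cr p b a = -cr p a b := by unfold cr; ring

theorem cr_self (p a : Plane) : cr p a a = 0 := by unfold cr; ring

theorem cr_left (p a : Plane) : cr p p a = 0 := by unfold cr; ring

theorem cr_right (p a : Plane) : cr p a p = 0 := by unfold cr; ring

/-- The Grassmann–Plücker relation, the basis for comparing directions seen from `p`. -/
theorem cr_plucker (p a b c d : Plane) :
    cr p a b * cr p c d - cr p a c * cr p b d + cr p a d * cr p b c = 0 := by unfold cr; ring

theorem cr_ne_zero {S : Finset Plane} (hS : InGeneralPosition S) {a b c : S}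
    (hab : a ≠ b) (hac : a ≠ c) (hbc : b ≠ c) : cr (a : Plane) b c ≠ 0 := by
  intro h
  refine hS a a.2 b b.2 c c.2 (fun h => hab (Subtype.ext h))
    (fun h => hac (Subtype.ext h)) (fun h => hbc (Subtype.ext h)) ?_
  rw [collinear_iff_of_mem (p₀ := (a : Plane)) (by simp)]
  have hne : (b : Plane) ≠ a := fun h => hab (Subtype.ext h.symm)
  refine ⟨(b : Plane) - a, ?_⟩
  have key : ∃ r : ℝ, (c : Plane) = r • ((b : Plane) - a) +ᵥ (a : Plane) := by
    unfold cr at h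
    by_cases h0 : (b : Plane) 0 - (a : Plane) 0 = 0
    · have h1 : (b : Plane) 1 - (a : Plane) 1 ≠ 0 := by
        intro h1
        apply hne
        ext i; fin_cases i
        · simpa [sub_eq_zero] using h0
        · simpa [sub_eq_zero] using h1
      refine ⟨((c : Plane) 1 - (a : Plane) 1) / ((b : Plane) 1 - (a : Plane) 1), ?_⟩
      rw [h0] at h
      have h2 : (c : Plane) 0 - (a : Plane) 0 = 0 := by
        rcases mul_eq_zero.1 (by linarith :
          ((b : Plane) 1 - (a : Plane) 1) * ((c : Plane) 0 - (a : Plane) 0) = 0) with h | h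
        · exact absurd h h1
        · exact h
      ext i; fin_cases i
      · simp [h0]; linarith
      · simp; field_simp; ring
    · refine ⟨((c : Plane) 0 - (a : Plane) 0) / ((b : Plane) 0 - (a : Plane) 0), ?_⟩
      ext i; fin_cases i
      · simp; field_simp; ring
      · simp; field_simp; linarith
  intro q hq
  rcases hq with rfl | rfl | rfl
  · exact ⟨0, by simp⟩
  · exact ⟨1, by simp⟩
  · exact key

/-- Seen from `p` in the orientation given by the sign of `ε`, the segment `pr` crosses the
segment `cd`, with `c` clockwise and `d` counterclockwise of `r`. -/
def Crosses (ε : ℝ) (p r c d : Plane) : Prop :=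
  0 < ε * cr p c r ∧ 0 < ε * cr p r d ∧ 0 < ε * cr p c d ∧
    ε * cr p c d < ε * cr p c r + ε * cr p r d

/-- Changing the orientation exchanges clockwise and counterclockwise; thus an argument for one side
of `r`, carried out for general `ε`, also covers the other. -/
theorem crosses_neg {ε : ℝ} {p r c d : Plane} : Crosses (-ε) p r c d ↔ Crosses ε p r d c := by
  unfold Crosses
  rw [cr_swap p c r, cr_swap p r d, cr_swap p c d]
  constructor <;> rintro ⟨h1, h2, h3, h4⟩ <;> refine ⟨?_, ?_, ?_, ?_⟩ <;> linarith

theorem mem_segment_of_weights {c d m : Plane} {s t : ℝ} (hs : 0 ≤ s) (ht : 0 ≤ t)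
    (hst : 0 < s + t) (h0 : (s + t) * m 0 = s * c 0 + t * d 0)
    (h1 : (s + t) * m 1 = s * c 1 + t * d 1) : m ∈ segment ℝ c d := by
  refine ⟨s / (s + t), t / (s + t), by positivity, by positivity, by field_simp, ?_⟩
  ext i; fin_cases i
  · simp; field_simp; linarith
  · simp; field_simp; linarith

theorem exists_lineMap_mem (p w : Plane) (k : ℝ) :
    ∃ m : Plane, m 0 = p 0 + k * (w 0 - p 0) ∧ m 1 = p 1 + k * (w 1 - p 1) :=
  ⟨p + k • (w - p), by simp, by simp⟩

/-- The point where the ray from `p` through `w` meets the segment `cd`. -/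
theorem exists_mem_segment_on_ray {ε : ℝ} {p w c d : Plane} (h1 : 0 < ε * cr p c w)
    (h2 : 0 < ε * cr p w d) :
    ∃ m ∈ segment ℝ c d, ∃ k : ℝ,
      k * (ε * cr p c w + ε * cr p w d) = ε * cr p c d ∧
      m 0 = p 0 + k * (w 0 - p 0) ∧ m 1 = p 1 + k * (w 1 - p 1) := by
  have hpos : 0 < ε * cr p c w + ε * cr p w d := by linarith
  obtain ⟨m, hm0, hm1⟩ := exists_lineMap_mem p w
    (ε * cr p c d / (ε * cr p c w + ε * cr p w d))
  have hk : ε * cr p c d / (ε * cr p c w + ε * cr p w d) * (ε * cr p c w + ε * cr p w d)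
    = ε * cr p c d := div_mul_cancel₀ _ hpos.ne'
  refine ⟨m, ?_, _, hk, hm0, hm1⟩
  generalize ε * cr p c d / (ε * cr p c w + ε * cr p w d) = k at *
  refine mem_segment_of_weights (s := ε * cr p w d) (t := ε * cr p c w) h2.le h1.le
    (by linarith) ?_ ?_
  · have : (ε * cr p w d + ε * cr p c w) * m 0 = (ε * cr p c w + ε * cr p w d) * p 0
        + k * (ε * cr p c w + ε * cr p w d) * (w 0 - p 0) := by rw [hm0]; ring
    rw [this, hk]; unfold cr; ring
  · have : (ε * cr p w d + ε * cr p c w) * m 1 = (ε * cr p c w + ε * cr p w d) * p 1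
        + k * (ε * cr p c w + ε * cr p w d) * (w 1 - p 1) := by rw [hm1]; ring
    rw [this, hk]; unfold cr; ring

/-- The ray from `p` through `r` meets `cd` at the parameter `k`, and the last two clauses of
`Crosses` amount to `0 < k < 1`. -/
theorem Crosses.exists_mem {ε : ℝ} {p r c d : Plane} (h : Crosses ε p r c d) :
    ∃ m, m ∈ segment ℝ p r ∧ m ∈ segment ℝ c d := by
  obtain ⟨h1, h2, h3, h4⟩ := h
  obtain ⟨m, hm, k, hk, hm0, hm1⟩ := exists_mem_segment_on_ray h1 h2
  have hpos : 0 < ε * cr p c r + ε * cr p r d := by linarith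
  have hk0 : 0 < k := by
    by_contra hk0
    nlinarith
  have hk1 : k < 1 := by
    by_contra hk1
    nlinarith
  refine ⟨m, ?_, hm⟩
  exact mem_segment_of_weights (s := 1 - k) (t := k) (by linarith) hk0.le (by linarith)
    (by rw [hm0]; ring) (by rw [hm1]; ring)

/-- In a plane drawing, an edge `cd` cannot pass through the edge `yx` within the cone that
`yx` spans at `p`. -/
theorem IsPlaneDrawing.not_pass {S : Finset Plane} {G : SimpleGraph S} (hG : IsPlaneDrawing G)
    {ε : ℝ} {p : Plane} {c d y x : S} (hcd : G.Adj c d) (hyx : G.Adj y x) {m₁ m₂ : Plane}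
    (hm₁ : m₁ ∈ segment ℝ (c : Plane) d) (hm₂ : m₂ ∈ segment ℝ (c : Plane) d)
    (hy₁ : 0 < ε * cr p y m₁) (hx₁ : 0 ≤ ε * cr p m₁ x)
    (hF₁ : ε * cr p y m₁ + ε * cr p m₁ x < ε * cr p y x)
    (hy₂ : 0 < ε * cr p y m₂) (hx₂ : 0 < ε * cr p m₂ x)
    (hF₂ : ε * cr p y x ≤ ε * cr p y m₂ + ε * cr p m₂ x) : False := by
  -- `f₁` and `-f₂` are the values at `m₁` and `m₂` of one affine function that vanishes on the line
  -- `yx`; `t` locates its zero between them.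
  set f₁ := ε * cr p y x - ε * cr p y m₁ - ε * cr p m₁ x with hf₁
  set f₂ := ε * cr p y m₂ + ε * cr p m₂ x - ε * cr p y x with hf₂
  have h1 : 0 < f₁ := by linarith
  have h2 : 0 ≤ f₂ := by linarith
  obtain ⟨t, ht0, ht1, hteq⟩ : ∃ t : ℝ, 0 < t ∧ t ≤ 1 ∧ (1 - t) * f₁ = t * f₂ := by
    refine ⟨f₁ / (f₁ + f₂), by positivity, ?_, by field_simp; ring⟩
    rw [div_le_one (by positivity)]; linarith
  obtain ⟨m, hm⟩ : ∃ m : Plane, m = (1 - t) • m₁ + t • m₂ := ⟨_, rfl⟩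
  have hmcd : m ∈ segment ℝ (c : Plane) d := by
    rw [hm]
    exact convex_segment _ _ hm₁ hm₂ (by linarith) ht0.le (by ring)
  have hm0 : m 0 = (1 - t) * m₁ 0 + t * m₂ 0 := by simp [hm]
  have hm1 : m 1 = (1 - t) * m₁ 1 + t * m₂ 1 := by simp [hm]
  have hym : ε * cr p y m = (1 - t) * (ε * cr p y m₁) + t * (ε * cr p y m₂) := by
    unfold cr; rw [hm0, hm1]; ring
  have hmx : ε * cr p m x = (1 - t) * (ε * cr p m₁ x) + t * (ε * cr p m₂ x) := by
    unfold cr; rw [hm0, hm1]; ring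
  have hymp : 0 < ε * cr p y m := by
    rw [hym]; nlinarith
  have hmxp : 0 < ε * cr p m x := by
    rw [hmx]; nlinarith
  have hsum : ε * cr p m x + ε * cr p y m = ε * cr p y x := by
    rw [hym, hmx]
    simp only [hf₁, hf₂] at hteq
    linarith
  have hmyx : m ∈ segment ℝ (y : Plane) x := by
    refine mem_segment_of_weights (s := ε * cr p m x) (t := ε * cr p y m) hmxp.le hymp.le
      (by linarith) ?_ ?_
    · rw [hsum]
      have h3 : ε * cr p y x * (m 0 - p 0)
        = ε * cr p m x * ((y : Plane) 0 - p 0) + ε * cr p y m * ((x : Plane) 0 - p 0) := by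
        unfold cr; ring
      linear_combination h3 - p 0 * hsum
    · rw [hsum]
      have h3 : ε * cr p y x * (m 1 - p 1)
        = ε * cr p m x * ((y : Plane) 1 - p 1) + ε * cr p y m * ((x : Plane) 1 - p 1) := by
        unfold cr; ring
      linear_combination h3 - p 1 * hsum
  have hne : s(c, d) ≠ s(y, x) := by
    intro he
    have hm₁' : m₁ ∈ segment ℝ (y : Plane) x := by
      rcases Sym2.eq_iff.1 he with ⟨rfl, rfl⟩ | ⟨rfl, rfl⟩
      · exact hm₁
      · rwa [segment_symm]
    obtain ⟨s, t', hs, ht', hst, rfl⟩ := hm₁'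
    have : ε * cr p y (s • (y : Plane) + t' • (x : Plane))
        + ε * cr p (s • (y : Plane) + t' • (x : Plane)) x = ε * cr p y x := by
      have hs' : s = 1 - t' := by linarith
      subst hs'
      unfold cr
      simp
      ring
    linarith
  have := (hG c d y x hcd hyx hne ⟨hmcd, hmyx⟩).2
  rcases this with rfl | h
  · simp [cr_self] at hymp
  · rw [Set.mem_singleton_iff] at h
    subst h
    simp [cr_self] at hmxp

/-! ### Visibility in a plane drawing -/

/-- No edge of `G` crosses the segment from `p` to `r`. -/
def Sees {S : Finset Plane} (G : SimpleGraph S) (p r : S) : Prop :=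
  ∀ c d : S, G.Adj c d → ¬ Crosses 1 (p : Plane) r c d

theorem sees_iff {S : Finset Plane} {G : SimpleGraph S} {p r : S} {ε : ℝ} (hε : ε = 1 ∨ ε = -1) :
    Sees G p r ↔ ∀ c d : S, G.Adj c d → ¬ Crosses ε (p : Plane) r c d := by
  rcases hε with rfl | rfl
  · rfl
  · simp only [crosses_neg]
    exact ⟨fun h c d hcd => h d c hcd.symm, fun h c d hcd => h d c hcd.symm⟩

/-- Transitivity of the angular order around `p`: by `cr_plucker`, `ac · bd = ab · cd + ad · bc`,
and the right-hand side is positive. The companion lemma solves for the other factor. -/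
theorem cr_pos_of_cone {ε : ℝ} {p a b c d : Plane} (hab : 0 < ε * cr p a b)
    (hcd : 0 ≤ ε * cr p c d) (had : 0 < ε * cr p a d) (hbc : 0 < ε * cr p b c)
    (hbd : 0 < ε * cr p b d) : 0 < ε * cr p a c := by
  have h : ε * cr p a b * (ε * cr p c d) - ε * cr p a c * (ε * cr p b d)
      + ε * cr p a d * (ε * cr p b c) = 0 := by
    linear_combination ε ^ 2 * cr_plucker p a b c d
  have h1 : 0 < ε * cr p a d * (ε * cr p b c) := mul_pos had hbc
  have h2 : 0 ≤ ε * cr p a b * (ε * cr p c d) := mul_nonneg hab.le hcd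
  exact pos_of_mul_pos_left (by linarith : 0 < ε * cr p a c * (ε * cr p b d)) hbd.le

theorem cr_pos_of_cone' {ε : ℝ} {p a b c d : Plane} (hab : 0 < ε * cr p a b)
    (hcd : 0 ≤ ε * cr p c d) (had : 0 < ε * cr p a d) (hbc : 0 < ε * cr p b c)
    (hac : 0 < ε * cr p a c) : 0 < ε * cr p b d := by
  have h : ε * cr p a b * (ε * cr p c d) - ε * cr p a c * (ε * cr p b d)
      + ε * cr p a d * (ε * cr p b c) = 0 := by
    linear_combination ε ^ 2 * cr_plucker p a b c d
  have h1 : 0 < ε * cr p a d * (ε * cr p b c) := mul_pos had hbc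
  have h2 : 0 ≤ ε * cr p a b * (ε * cr p c d) := mul_nonneg hab.le hcd
  exact pos_of_mul_pos_right (by linarith : 0 < ε * cr p a c * (ε * cr p b d)) hac.le

set_option maxHeartbeats 600000 in
/-- Below the edge `yx` that blocks the view from `p` to `r` first there is a visible point in the
angle between `r` and `x`. -/
theorem exists_sees_of_first_blocking {S : Finset Plane} (hS : InGeneralPosition S)
    {G : SimpleGraph S} (hG : IsPlaneDrawing G) {ε : ℝ} (hε : ε = 1 ∨ ε = -1) {p r y x : S}
    (hpr : p ≠ r) (hyx : G.Adj y x) (hc : Crosses ε (p : Plane) r y x)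
    (hmin : ∀ c d : S, G.Adj c d → Crosses ε (p : Plane) r c d →
      ε * cr p y x * (ε * cr p c r + ε * cr p r d)
        ≤ ε * cr p c d * (ε * cr p y r + ε * cr p r x)) :
    ∃ w : S, Sees G p w ∧ 0 < ε * cr (p : Plane) r w ∧ 0 ≤ ε * cr (p : Plane) w x := by
  obtain ⟨hyr, hrx, hyx0, hF⟩ := hc
  -- The candidates lie in the triangle bounded by the rays through `r` and `x` and the line `yx`,
  -- with the ray through `r` excluded.
  let C : Set S := {w | 0 < ε * cr (p : Plane) r w ∧ 0 ≤ ε * cr (p : Plane) w x ∧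
    ε * cr (p : Plane) y w + ε * cr (p : Plane) w x ≤ ε * cr (p : Plane) y x}
  have hyC : ∀ w ∈ C, 0 < ε * cr (p : Plane) y w := fun w hw =>
    cr_pos_of_cone hyr hw.2.1 hyx0 hw.1 hrx
  have hxC : x ∈ C := ⟨hrx, by simp [cr_self], by simp [cr_self]⟩
  -- The ratio grows with the angle from `r`, so `w` comes first when turning from `r` to `x`.
  obtain ⟨w, hw, hwmin⟩ := Set.exists_min_image C
    (fun w => ε * cr (p : Plane) r w / (ε * cr (p : Plane) y w)) (Set.toFinite C) ⟨x, hxC⟩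
  have hwmin' : ∀ c ∈ C, 0 ≤ ε * cr (p : Plane) w c := by
    intro c hcC
    have h := hwmin c hcC
    rw [div_le_div_iff₀ (hyC w hw) (hyC c hcC)] at h
    have hP : ε * cr (p : Plane) y r * (ε * cr (p : Plane) w c) =
        ε * cr (p : Plane) y w * (ε * cr (p : Plane) r c)
        - ε * cr (p : Plane) y c * (ε * cr (p : Plane) r w) := by
      linear_combination ε ^ 2 * cr_plucker (p : Plane) y r w c
    exact nonneg_of_mul_nonneg_right (by linarith) hyr
  have hyw := hyC w hw
  refine ⟨w, (sees_iff hε).2 ?_, hw.1, hw.2.1⟩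
  -- An edge `cd` hiding `w` would contain a point `m` strictly below `yx`. By planarity (`hpass`)
  -- it cannot also reach the far side of `yx` inside the angle.
  rintro c d hcd ⟨hcw, hwd, hcd0, hlt⟩
  obtain ⟨m, hm, k, hk, hm0, hm1⟩ := exists_mem_segment_on_ray hcw hwd
  have hk0 : 0 < k := pos_of_mul_pos_left (by linarith) (by linarith :
    0 ≤ ε * cr (p : Plane) c w + ε * cr (p : Plane) w d)
  have hk1 : k < 1 := by
    by_contra hk1
    nlinarith
  have hym : ε * cr (p : Plane) y m = k * (ε * cr (p : Plane) y w) := by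
    unfold cr; rw [hm0, hm1]; ring
  have hmx : ε * cr (p : Plane) m x = k * (ε * cr (p : Plane) w x) := by
    unfold cr; rw [hm0, hm1]; ring
  have hpass : ∀ n ∈ segment ℝ (c : Plane) d, 0 < ε * cr (p : Plane) y n →
      0 < ε * cr (p : Plane) n x →
      ε * cr (p : Plane) y x ≤ ε * cr (p : Plane) y n + ε * cr (p : Plane) n x → False := by
    intro n hn h1 h2 h3
    refine hG.not_pass hcd hyx hm hn ?_ ?_ ?_ h1 h2 h3
    · rw [hym]; positivity
    · rw [hmx]; exact mul_nonneg hk0.le hw.2.1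
    · rw [hym, hmx]
      have := hw.2.2
      have := hw.2.1
      nlinarith
  -- If `c` is clockwise of `r`, then `cd` meets the ray through `r` either beyond `yx` or before
  -- the first blocking edge. If `c = r`, it lies beyond `yx`. If `c` is counterclockwise of `r`, it
  -- is either beyond `yx` or a candidate preceding `w`.
  rcases lt_trichotomy (ε * cr (p : Plane) r c) 0 with hrc | hrc | hrc
  · have hcr : 0 < ε * cr (p : Plane) c r := by rw [cr_swap]; linarith
    have hrd : 0 < ε * cr (p : Plane) r d :=
      cr_pos_of_cone' hcr hwd.le hcd0 hw.1 hcw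
    obtain ⟨n, hn, l, hl, hn0, hn1⟩ := exists_mem_segment_on_ray hcr hrd
    have hl0 : 0 < l := pos_of_mul_pos_left (by linarith) (by linarith :
      0 ≤ ε * cr (p : Plane) c r + ε * cr (p : Plane) r d)
    have hyn : ε * cr (p : Plane) y n = l * (ε * cr (p : Plane) y r) := by
      unfold cr; rw [hn0, hn1]; ring
    have hnx : ε * cr (p : Plane) n x = l * (ε * cr (p : Plane) r x) := by
      unfold cr; rw [hn0, hn1]; ring
    by_cases hl1 : ε * cr (p : Plane) y x ≤ ε * cr (p : Plane) y n + ε * cr (p : Plane) n x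
    · exact hpass n hn (by rw [hyn]; positivity) (by rw [hnx]; positivity) hl1
    · push Not at hl1
      rw [hyn, hnx] at hl1
      have hl2 : l < 1 := by
        by_contra hl2
        nlinarith
      have := hmin c d hcd ⟨hcr, hrd, hcd0, by nlinarith⟩
      rw [← hl] at this
      nlinarith
  · have hcr : c = r := by
      by_contra hcr
      have hpc : p ≠ c := by
        rintro rfl
        simp [cr_left] at hcw
      have := cr_ne_zero hS hpr hpc (fun h => hcr h.symm)
      exact (this (by rcases hε with rfl | rfl <;> linarith)).elim
    subst hcr
    exact hpass c (left_mem_segment _ _ _) hyr hrx hF.le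
  · have hcx : 0 < ε * cr (p : Plane) c x :=
      cr_pos_of_cone' hrc hw.2.1 hrx hcw hw.1
    have hyc : 0 < ε * cr (p : Plane) y c := cr_pos_of_cone hyr hcx.le hyx0 hrc hrx
    refine hpass c (left_mem_segment _ _ _) hyc hcx ?_
    by_contra hlt'
    have := hwmin' c ⟨hrc, hcx.le, by linarith⟩
    rw [cr_swap] at this
    linarith

/-- If `p` does not see `r`, then some edge `yx` blocks the view and `p` sees a point in
either of the angles that `r` forms with `x` and with `y`. -/
theorem exists_sees_of_not_sees {S : Finset Plane} (hS : InGeneralPosition S)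
    {G : SimpleGraph S} (hG : IsPlaneDrawing G) {p r : S} (hpr : p ≠ r) (h : ¬ Sees G p r) :
    ∃ y x : S, G.Adj y x ∧ Crosses 1 (p : Plane) r y x ∧
      (∃ w : S, Sees G p w ∧ 0 < cr (p : Plane) r w ∧ 0 ≤ cr (p : Plane) w x) ∧
      ∃ w : S, Sees G p w ∧ 0 < cr (p : Plane) w r ∧ 0 ≤ cr (p : Plane) y w := by
  let E : Set (S × S) := {e | G.Adj e.1 e.2 ∧ Crosses 1 (p : Plane) r e.1 e.2}
  have hE : E.Nonempty := by
    unfold Sees at h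
    push Not at h
    obtain ⟨c, d, h1, h2⟩ := h
    exact ⟨(c, d), h1, h2⟩
  -- The minimised ratio is the parameter of the crossing along `pr`.
  obtain ⟨⟨y, x⟩, ⟨hyx, hc⟩, hmin⟩ := Set.exists_min_image E
    (fun e => 1 * cr (p : Plane) e.1 e.2 / (1 * cr (p : Plane) e.1 r + 1 * cr (p : Plane) r e.2))
    (Set.toFinite E) hE
  have hmin' : ∀ c d : S, G.Adj c d → Crosses 1 (p : Plane) r c d →
      1 * cr (p : Plane) y x * (1 * cr (p : Plane) c r + 1 * cr (p : Plane) r d)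
        ≤ 1 * cr (p : Plane) c d * (1 * cr (p : Plane) y r + 1 * cr (p : Plane) r x) := by
    intro c d hcd hcr
    have := hmin (c, d) ⟨hcd, hcr⟩
    rwa [div_le_div_iff₀] at this
    · have h1 := hc.1; have h2 := hc.2.1
      dsimp only
      linarith
    · have h1 := hcr.1; have h2 := hcr.2.1
      dsimp only
      linarith
  refine ⟨y, x, hyx, hc, ?_, ?_⟩
  · simpa using exists_sees_of_first_blocking hS hG (Or.inl rfl) hpr hyx hc hmin'
  · obtain ⟨w, hw, h1, h2⟩ := exists_sees_of_first_blocking (ε := -1) hS hG (Or.inr rfl) hpr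
      hyx.symm (crosses_neg.2 hc) (by
        intro c d hcd hcr
        have := hmin' d c hcd.symm (crosses_neg.1 hcr)
        rw [cr_swap (p : Plane) y x, cr_swap (p : Plane) d r, cr_swap (p : Plane) r c,
          cr_swap (p : Plane) d c, cr_swap (p : Plane) y r, cr_swap (p : Plane) r x]
        linarith)
    refine ⟨w, hw, ?_, ?_⟩
    · rw [cr_swap]; linarith
    · rw [cr_swap]; linarith

theorem exists_sees_of_not_sees' {S : Finset Plane} (hS : InGeneralPosition S)
    {G : SimpleGraph S} (hG : IsPlaneDrawing G) {ε : ℝ} (hε : ε = 1 ∨ ε = -1) {p r : S}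
    (hpr : p ≠ r) (h : ¬ Sees G p r) :
    ∃ y x : S, G.Adj y x ∧ Crosses ε (p : Plane) r y x ∧
      (∃ w : S, Sees G p w ∧ 0 < ε * cr (p : Plane) r w ∧ 0 ≤ ε * cr (p : Plane) w x) ∧
      ∃ w : S, Sees G p w ∧ 0 < ε * cr (p : Plane) w r ∧ 0 ≤ ε * cr (p : Plane) y w := by
  obtain ⟨y, x, hyx, hc, ⟨w, hw, h1, h2⟩, w', hw', h3, h4⟩ := exists_sees_of_not_sees hS hG hpr h
  rcases hε with rfl | rfl
  · exact ⟨y, x, hyx, hc, ⟨w, hw, by linarith, by linarith⟩, w', hw', by linarith, by linarith⟩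
  · refine ⟨x, y, hyx.symm, crosses_neg.2 hc, ⟨w', hw', ?_, ?_⟩, w, hw, ?_, ?_⟩
    · rw [cr_swap] at h3; linarith
    · rw [cr_swap] at h4; linarith
    · rw [cr_swap] at h1; linarith
    · rw [cr_swap] at h2; linarith

theorem ne_of_cr_pos_right {S : Finset Plane} {ε : ℝ} {p r w : S}
    (h : 0 < ε * cr (p : Plane) r w) : w ≠ p := by
  rintro rfl
  simp [cr_right] at h

theorem ne_of_cr_pos_left {S : Finset Plane} {ε : ℝ} {p r w : S}
    (h : 0 < ε * cr (p : Plane) w r) : w ≠ p := by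
  rintro rfl
  simp [cr_left] at h

theorem not_cr_pos_symm {ε : ℝ} {p a b : Plane} (h : 0 < ε * cr p a b)
    (h' : 0 ≤ ε * cr p b a) : False := by
  rw [cr_swap] at h'
  linarith

/-- The segments `pr` and `ab` cross. -/
def CrossesPair (p r a b : Plane) : Prop := Crosses 1 p r a b ∨ Crosses 1 p r b a

theorem CrossesPair.symm {p r a b : Plane} (h : CrossesPair p r a b) : CrossesPair p r b a :=
  Or.symm h

/-- Four points split into two pairs in three ways, and at most one of these gives crossing
segments. -/
theorem CrossesPair.false_of_swap {p r a b : Plane} (h : CrossesPair p r a b)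
    (h' : CrossesPair a r p b) : False := by
  rcases h with ⟨h1, h2, h3, h4⟩ | ⟨h1, h2, h3, h4⟩ <;>
  rcases h' with ⟨h5, h6, h7, h8⟩ | ⟨h5, h6, h7, h8⟩ <;>
  simp only [cr] at * <;> linarith

theorem IsPlaneDrawing.not_crossesPair {S : Finset Plane} {G : SimpleGraph S}
    (hG : IsPlaneDrawing G) {p r a b : S} (hpr : G.Adj p r) (hab : G.Adj a b) (hpa : p ≠ a)
    (hpb : p ≠ b) (hra : r ≠ a) (hrb : r ≠ b) : ¬ CrossesPair (p : Plane) r a b := by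
  intro h
  have : ∃ m, m ∈ segment ℝ (p : Plane) r ∧ m ∈ segment ℝ (a : Plane) b := by
    rcases h with h | h
    · exact h.exists_mem
    · rw [segment_symm ℝ (a : Plane) b]
      exact h.exists_mem
  obtain ⟨m, hm⟩ := this
  have hne : s(p, r) ≠ s(a, b) := by
    rw [Ne, Sym2.eq_iff]; tauto
  obtain ⟨h1, h2⟩ := hG p r a b hpr hab hne hm
  simp only [Set.mem_insert_iff, Set.mem_singleton_iff] at h1 h2
  rcases h1 with rfl | rfl <;> rcases h2 with h | h <;> have := Subtype.ext h <;> tauto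

/-- If `r` is hidden, the visible points on its two sides are distinct, so one of them is not `a`.
-/
theorem exists_sees_ne {S : Finset Plane} (hS : InGeneralPosition S) {G : SimpleGraph S}
    (hG : IsPlaneDrawing G) {p a r : S} (hr : r ≠ p) (hra : r ≠ a) :
    ∃ v : S, v ≠ p ∧ v ≠ a ∧ Sees G p v := by
  by_cases h : Sees G p r
  · exact ⟨r, hr, hra, h⟩
  obtain ⟨y, x, hyx, hc, ⟨w, hw, h1, h2⟩, w', hw', h3, h4⟩ :=
    exists_sees_of_not_sees' hS hG (Or.inl rfl) hr.symm h
  by_cases hwa : w = a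
  · refine ⟨w', ne_of_cr_pos_left h3, ?_, hw'⟩
    rintro rfl
    subst hwa
    exact not_cr_pos_symm h1 h3.le
  · exact ⟨w, ne_of_cr_pos_right h1, hwa, hw⟩

/-- If `p` sees only `a` and `b`, then `ab` is an edge that blocks the view to everything else. -/
theorem crossesPair_of_sees_only {S : Finset Plane} (hS : InGeneralPosition S)
    {G : SimpleGraph S} (hG : IsPlaneDrawing G) {p a b : S}
    (hvis : ∀ r, r ≠ p → Sees G p r → r = a ∨ r = b) {r : S} (hrp : r ≠ p) (hra : r ≠ a)
    (hrb : r ≠ b) : G.Adj a b ∧ CrossesPair (p : Plane) r a b := by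
  have hns : ∀ r, r ≠ p → r ≠ a → r ≠ b → ¬ Sees G p r := fun r h1 h2 h3 h => by
    rcases hvis r h1 h <;> contradiction
  obtain ⟨y, x, hyx, hc, ⟨w, hw, h1, h2⟩, w', hw', h3, h4⟩ :=
    exists_sees_of_not_sees' hS hG (Or.inl rfl) hrp.symm (hns r hrp hra hrb)
  obtain ⟨c1, c2, c3, c4⟩ := hc
  have hww : w ≠ w' := by
    rintro rfl
    exact not_cr_pos_symm h1 h3.le
  have hwv := hvis w (ne_of_cr_pos_right h1) hw
  have hwv' := hvis w' (ne_of_cr_pos_left h3) hw'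
  have hall : ∀ v, v ≠ p → Sees G p v → v = w ∨ v = w' := by
    intro v hv hv'
    have := hvis v hv hv'
    grind
  have hw'x : 0 < 1 * cr (p : Plane) w' x := by
    have h : 1 * cr (p : Plane) y r * (1 * cr (p : Plane) w' x) =
        1 * cr (p : Plane) y w' * (1 * cr (p : Plane) r x)
        + 1 * cr (p : Plane) y x * (1 * cr (p : Plane) w' r) := by
      unfold cr; ring
    have := mul_pos c3 h3
    have := mul_nonneg h4 c2.le
    exact pos_of_mul_pos_right (by linarith) c1.le
  have hyw : 0 < 1 * cr (p : Plane) y w := cr_pos_of_cone c1 h2 c3 h1 c2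
  have hxp := ne_of_cr_pos_right c2
  have hyp := ne_of_cr_pos_left c1
  -- Were `x` hidden, a visible point would lie strictly counterclockwise of it; but neither `w` nor
  -- `w'` does. The end `y` is treated symmetrically.
  have hxw : x = w := by
    by_contra hxw
    have hns : ¬ Sees G p x := by
      intro h
      rcases hall x hxp h with h | h
      · exact hxw h
      · subst h
        simp [cr_self] at hw'x
    obtain ⟨-, -, -, -, ⟨v, hv, hv1, -⟩, -⟩ :=
      exists_sees_of_not_sees' hS hG (Or.inl rfl) hxp.symm hns
    rcases hall v (ne_of_cr_pos_right hv1) hv with rfl | rfl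
    · exact not_cr_pos_symm hv1 h2
    · exact not_cr_pos_symm hv1 hw'x.le
  have hyw' : y = w' := by
    by_contra hyw'
    have hns : ¬ Sees G p y := by
      intro h
      rcases hall y hyp h with h | h
      · subst h
        simp [cr_self] at hyw
      · exact hyw' h
    obtain ⟨-, -, -, -, -, v, hv, hv1, -⟩ :=
      exists_sees_of_not_sees' hS hG (Or.inl rfl) hyp.symm hns
    rcases hall v (ne_of_cr_pos_left hv1) hv with rfl | rfl
    · exact not_cr_pos_symm hv1 hyw.le
    · exact not_cr_pos_symm hv1 h4
  subst hxw hyw'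
  rcases hwv with rfl | rfl <;> rcases hwv' with rfl | rfl
  · exact absurd rfl hww
  · exact ⟨hyx.symm, Or.inr ⟨c1, c2, c3, c4⟩⟩
  · exact ⟨hyx, Or.inl ⟨c1, c2, c3, c4⟩⟩
  · exact absurd rfl hww

/-- If `ab` blocks the view from `p` to all further points, then those lie, seen from `a`, on one
side of `b` and of `p`. -/
theorem exists_orientation_of_crossesPair {S : Finset Plane} {p a b : S}
    (hD : ∀ r : S, r ≠ p → r ≠ a → r ≠ b → CrossesPair (p : Plane) r a b) :
    ∃ ε : ℝ, (ε = 1 ∨ ε = -1) ∧ ∀ t : S, t ≠ p → t ≠ a → t ≠ b →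
      0 < ε * cr (a : Plane) t b ∧ 0 < ε * cr (a : Plane) t p := by
  rcases le_or_gt (cr (p : Plane) a b) 0 with h0 | h0
  · refine ⟨-1, Or.inr rfl, fun t h1 h2 h3 => ?_⟩
    rcases hD t h1 h2 h3 with ⟨g1, g2, g3, g4⟩ | ⟨g1, g2, g3, g4⟩
    · linarith
    · simp only [cr] at *
      constructor <;> linarith
  · refine ⟨1, Or.inl rfl, fun t h1 h2 h3 => ?_⟩
    rcases hD t h1 h2 h3 with ⟨g1, g2, g3, g4⟩ | ⟨g1, g2, g3, g4⟩
    · simp only [cr] at *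
      constructor <;> linarith
    · rw [cr_swap] at g3
      linarith

/-- Seen from `a`, all further points lie on one side of both `p` and `b`, so a visible point beyond
such a point, away from `p` and `b`, can only be `c`. This forces the edge hiding `x` to join `c` to
`p` or `b`, and `pc` is not an edge. -/
theorem adj_and_crossesPair_of_sees_only {S : Finset Plane} (hS : InGeneralPosition S)
    {G : SimpleGraph S} (hG : IsPlaneDrawing G) {p a b c : S}
    (hD : ∀ r : S, r ≠ p → r ≠ a → r ≠ b → CrossesPair (p : Plane) r a b)
    (hvis : ∀ r, r ≠ a → Sees G a r → r = p ∨ r = b ∨ r = c) (hpc : ¬ G.Adj p c) {x : S}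
    (hxp : x ≠ p) (hxa : x ≠ a) (hxb : x ≠ b) (hxc : x ≠ c) :
    G.Adj b c ∧ CrossesPair (a : Plane) x b c := by
  obtain ⟨ε, hε, hside⟩ := exists_orientation_of_crossesPair hD
  have hns : ∀ r, r ≠ a → r ≠ p → r ≠ b → r ≠ c → ¬ Sees G a r := fun r h1 h2 h3 h4 h => by
    rcases hvis r h1 h with h | h | h <;> contradiction
  obtain ⟨y, z, hyz, ⟨c1, c2, c3, c4⟩, ⟨w, hw, h1, h2⟩, w', hw', h3, h4⟩ :=
    exists_sees_of_not_sees' hS hG hε hxa.symm (hns x hxa hxp hxb hxc)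
  have hright : ∀ t v : S, t ≠ p → t ≠ a → t ≠ b → Sees G a v → 0 < ε * cr (a : Plane) v t →
      v = c := by
    intro t v h1 h2 h3 hv h
    obtain ⟨g1, g2⟩ := hside t h1 h2 h3
    rcases hvis v (ne_of_cr_pos_left h) hv with rfl | rfl | rfl
    · exact (not_cr_pos_symm h g2.le).elim
    · exact (not_cr_pos_symm h g1.le).elim
    · rfl
  obtain rfl : w' = c := hright x w' hxp hxa hxb hw' h3
  have hwpb : w = p ∨ w = b := by
    rcases hvis w (ne_of_cr_pos_right h1) hw with h | h | rfl
    · exact Or.inl h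
    · exact Or.inr h
    · exact (not_cr_pos_symm h1 h3.le).elim
  have hza := ne_of_cr_pos_right c2
  have hya := ne_of_cr_pos_left c1
  have hz : z = p ∨ z = b := by
    by_contra hz
    push Not at hz
    obtain ⟨g1, g2⟩ := hside z hz.1 hza hz.2
    rcases hwpb with rfl | rfl
    · exact not_cr_pos_symm g2 h2
    · exact not_cr_pos_symm g1 h2
  have hx := hside x hxp hxa hxb
  have hyp : y ≠ p := by
    rintro rfl
    exact not_cr_pos_symm c1 hx.2.le
  have hyb : y ≠ b := by
    rintro rfl
    exact not_cr_pos_symm c1 hx.1.le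
  obtain rfl : y = w' := by
    by_contra hyc
    obtain ⟨-, -, -, -, -, v, hv, hv1, -⟩ :=
      exists_sees_of_not_sees' hS hG hε hya.symm (hns y hya hyp hyb hyc)
    obtain rfl := hright y v hyp hya hyb hv hv1
    exact not_cr_pos_symm hv1 h4
  rcases hz with rfl | rfl
  · exact absurd hyz.symm hpc
  · refine ⟨hyz.symm, ?_⟩
    rcases hε with rfl | rfl
    · exact Or.inr ⟨c1, c2, c3, c4⟩
    · exact Or.inl (crosses_neg.1 ⟨c1, c2, c3, c4⟩)

/-! ### From non-crossing to disjointness of segments -/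

theorem eq_of_mem_segment_of_mem_segment {q a b m : Plane} (h : cr q a b ≠ 0)
    (hma : m ∈ segment ℝ q a) (hmb : m ∈ segment ℝ q b) : m = q := by
  obtain ⟨s, t, hs, ht, hst, rfl⟩ := hma
  obtain ⟨s', t', hs', ht', hst', he⟩ := hmb
  have hs1 : s = 1 - t := by linarith
  have hs1' : s' = 1 - t' := by linarith
  subst hs1 hs1'
  have h0 : cr q ((1 - t) • q + t • a) b = t * cr q a b := by
    simp [cr]; ring
  rw [← he] at h0
  have h1 : cr q ((1 - t') • q + t' • b) b = 0 := by
    simp [cr]; ring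
  rw [h1] at h0
  have ht0 : t = 0 := by simpa [h] using h0.symm
  simp [ht0]

/-- A segment that an edge does not cross meets it at most in a common endpoint. -/
theorem segment_inter_of_not_crossesPair {S : Finset Plane} (hS : InGeneralPosition S)
    {p c x y : S} (hpc : p ≠ c) (hxy : x ≠ y) (hne : s(p, c) ≠ s(x, y))
    (h : ¬ CrossesPair (p : Plane) c x y) :
    segment ℝ (p : Plane) c ∩ segment ℝ (x : Plane) y ⊆
      ({(p : Plane), (c : Plane)} ∩ {(x : Plane), (y : Plane)} : Set Plane) := by
  rintro m ⟨hm, hm'⟩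
  have hne' : ¬ ((p = x ∧ c = y) ∨ (p = y ∧ c = x)) := by
    rwa [Ne, Sym2.eq_iff] at hne
  by_cases hpx : p = x
  · subst hpx
    rw [eq_of_mem_segment_of_mem_segment
      (cr_ne_zero hS hpc hxy (fun h => hne' (Or.inl ⟨rfl, h⟩))) hm hm']
    simp
  by_cases hpy : p = y
  · subst hpy
    rw [segment_symm] at hm'
    rw [eq_of_mem_segment_of_mem_segment
      (cr_ne_zero hS hpc hxy.symm (fun h => hne' (Or.inr ⟨rfl, h⟩))) hm hm']
    simp
  by_cases hcx : c = x
  · subst hcx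
    rw [segment_symm] at hm
    rw [eq_of_mem_segment_of_mem_segment (cr_ne_zero hS hpc.symm hxy hpy) hm hm']
    simp
  by_cases hcy : c = y
  · subst hcy
    rw [segment_symm] at hm hm'
    rw [eq_of_mem_segment_of_mem_segment (cr_ne_zero hS hpc.symm hxy.symm hpx) hm hm']
    simp
  exfalso
  have e1 := cr_ne_zero hS hpc hpx hcx
  have e2 := cr_ne_zero hS hpc hpy hcy
  have e3 := cr_ne_zero hS hpx hpy hxy
  have e4 := cr_ne_zero hS hcx hcy hxy
  obtain ⟨s, t, hs, ht, hst, he⟩ := hm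
  obtain ⟨γ, δ, hγ, hδ, hγδ, he'⟩ := hm'
  have m0 : s * (p : Plane) 0 + t * (c : Plane) 0 = γ * (x : Plane) 0 + δ * (y : Plane) 0 := by
    simpa using congrArg (fun v : Plane => v 0) (he.trans he'.symm)
  have m1 : s * (p : Plane) 1 + t * (c : Plane) 1 = γ * (x : Plane) 1 + δ * (y : Plane) 1 := by
    simpa using congrArg (fun v : Plane => v 1) (he.trans he'.symm)
  -- With four distinct endpoints, the position of the common point on the two segments gives the
  -- signs that `Crosses` asks for; general position makes them strict.
  have f1 : t * cr (p : Plane) x c = δ * cr (p : Plane) x y := by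
    obtain rfl : s = 1 - t := by linarith
    obtain rfl : γ = 1 - δ := by linarith
    unfold cr
    linear_combination ((x : Plane) 0 - (p : Plane) 0) * m1 - ((x : Plane) 1 - (p : Plane) 1) * m0
  have f2 : t * cr (p : Plane) c y = γ * cr (p : Plane) x y := by
    obtain rfl : s = 1 - t := by linarith
    obtain rfl : δ = 1 - γ := by linarith
    unfold cr
    linear_combination ((y : Plane) 1 - (p : Plane) 1) * m0 - ((y : Plane) 0 - (p : Plane) 0) * m1
  rw [cr_swap] at e1
  have ht0 : t ≠ 0 := by
    rintro rfl
    simp only [zero_mul, zero_eq_mul, e3, or_false] at f1 f2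
    linarith
  have ht0' : 0 < t := lt_of_le_of_ne ht ht0.symm
  have hδ0 : 0 < δ := by
    refine lt_of_le_of_ne hδ fun h0 => ?_
    simp only [← h0, zero_mul, mul_eq_zero, ht0, false_or] at f1
    exact e1 (by rw [f1, neg_zero])
  have hγ0 : 0 < γ := by
    refine lt_of_le_of_ne hγ fun h0 => ?_
    simp only [← h0, zero_mul, mul_eq_zero, ht0, false_or] at f2
    exact e2 f2
  have hsum : t * (cr (p : Plane) x c + cr (p : Plane) c y) = cr (p : Plane) x y := by
    linear_combination f1 + f2 + cr (p : Plane) x y * hγδ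
  have ht1 : t < 1 := by
    refine lt_of_le_of_ne (by linarith) fun h1 => e4 ?_
    rw [h1] at hsum
    unfold cr at *
    linarith
  rcases lt_or_gt_of_ne e3 with h3 | h3
  · have g1 : cr (p : Plane) x c < 0 := by
      by_contra! g
      nlinarith [mul_nonneg ht g]
    have g2 : cr (p : Plane) c y < 0 := by
      by_contra! g
      nlinarith [mul_nonneg ht g]
    refine h (Or.inr ⟨?_, ?_, ?_, ?_⟩)
    · rw [cr_swap]; linarith
    · rw [cr_swap]; linarith
    · rw [cr_swap]; linarith
    · rw [cr_swap (p : Plane) x y, cr_swap (p : Plane) c y, cr_swap (p : Plane) x c]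
      nlinarith
  · have g1 : 0 < cr (p : Plane) x c := by
      by_contra! g
      nlinarith [mul_nonneg ht (neg_nonneg.2 g)]
    have g2 : 0 < cr (p : Plane) c y := by
      by_contra! g
      nlinarith [mul_nonneg ht (neg_nonneg.2 g)]
    exact h (Or.inl ⟨by linarith, by linarith, by linarith, by nlinarith⟩)

/-! ### Paths as lists -/

/-- The edges between consecutive entries of a list. -/
def edgeList {V : Type*} : List V → List (Sym2 V)
  | a :: b :: l => s(a, b) :: edgeList (b :: l)
  | _ => []

theorem mem_of_mem_edgeList {V : Type*} {e : Sym2 V} {v : V} (hv : v ∈ e) :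
    ∀ {l : List V}, e ∈ edgeList l → v ∈ l
  | [], h => by simp [edgeList] at h
  | [_], h => by simp [edgeList] at h
  | a :: b :: l, h => by
    rw [edgeList, List.mem_cons] at h
    rcases h with rfl | h
    · rcases Sym2.mem_iff.1 hv with rfl | rfl <;> simp
    · exact List.mem_cons_of_mem _ (mem_of_mem_edgeList hv h)

theorem edgeList_append {V : Type*} (q c : V) (B : List V) :
    ∀ A : List V, edgeList (A ++ q :: c :: B) =
      edgeList (A ++ [q]) ++ s(q, c) :: edgeList (c :: B)
  | [] => by simp [edgeList]
  | [a] => by simp [edgeList]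
  | a :: b :: A => by
    have := edgeList_append q c B (b :: A)
    simp only [List.cons_append, edgeList] at this ⊢
    rw [this]

theorem mem_edgeList_reverse {V : Type*} {e : Sym2 V} :
    ∀ {l : List V}, e ∈ edgeList l.reverse ↔ e ∈ edgeList l
  | [] => by simp
  | [_] => by simp
  | a :: b :: l => by
    have := mem_edgeList_reverse (e := e) (l := b :: l)
    simp only [List.reverse_cons, List.append_assoc, List.cons_append, List.nil_append] at this ⊢
    rw [edgeList_append, List.mem_append, this]
    simp [edgeList, Sym2.eq_swap (a := b), or_comm]

theorem SimpleGraph.Walk.edges_eq_edgeList {V : Type*} {G : SimpleGraph V} {u v : V}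
    (p : G.Walk u v) : p.edges = edgeList p.support := by
  induction p with
  | nil => simp [edgeList]
  | cons h p ih =>
    rw [SimpleGraph.Walk.edges_cons, SimpleGraph.Walk.support_cons, ih]
    cases p <;> simp [edgeList]

theorem not_isDiag_of_mem_edgeList {V : Type*} {e : Sym2 V} :
    ∀ {l : List V}, l.Nodup → e ∈ edgeList l → ¬ e.IsDiag
  | [], _, h => by simp [edgeList] at h
  | [_], _, h => by simp [edgeList] at h
  | a :: b :: l, hl, h => by
    rw [edgeList, List.mem_cons] at h
    rcases h with rfl | h
    · simp only [List.nodup_cons, List.mem_cons, not_or] at hl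
      simpa using hl.1.1
    · exact not_isDiag_of_mem_edgeList hl.of_cons h

/-- The head lies on just one edge, which determines the next entry; induct on the rest. -/
theorem eq_of_edgeList_eq {V : Type*} : ∀ {l₁ l₂ : List V} {a : V}, (a :: l₁).Nodup →
    (a :: l₂).Nodup → (∀ e, e ∈ edgeList (a :: l₁) ↔ e ∈ edgeList (a :: l₂)) → l₁ = l₂
  | [], [], _, _, _, _ => rfl
  | [], y :: t, a, _, _, h => by simpa [edgeList] using h s(a, y)
  | x :: t, [], a, _, _, h => by simpa [edgeList] using h s(a, x)
  | x :: t, y :: t', a, h₁, h₂, h => by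
    have hx : s(a, x) ∈ edgeList (a :: y :: t') := (h _).1 (by simp [edgeList])
    have hn₁ : ∀ e, e ∈ edgeList (x :: t) → a ∉ e := fun e he ha =>
      (List.nodup_cons.1 h₁).1 (mem_of_mem_edgeList ha he)
    have hn₂ : ∀ e, e ∈ edgeList (y :: t') → a ∉ e := fun e he ha =>
      (List.nodup_cons.1 h₂).1 (mem_of_mem_edgeList ha he)
    obtain rfl : x = y := by
      rw [edgeList, List.mem_cons] at hx
      rcases hx with hx | hx
      · rcases Sym2.eq_iff.1 hx with hx | hx
        · exact hx.2
        · exact hx.2.trans hx.1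
      · exact (hn₂ _ hx (Sym2.mem_mk_left _ _)).elim
    rw [eq_of_edgeList_eq h₁.of_cons h₂.of_cons fun e => ?_]
    by_cases ha : a ∈ e
    · exact ⟨fun he => (hn₁ e he ha).elim, fun he => (hn₂ e he ha).elim⟩
    · have hne : e ≠ s(a, x) := by
        rintro rfl
        exact ha (Sym2.mem_mk_left _ _)
      simpa [edgeList, hne] using h e

/-- The path that visits the entries of a list in order. -/
def pathGraph {V : Type*} (l : List V) : SimpleGraph V :=
  SimpleGraph.fromEdgeSet {e | e ∈ edgeList l}

theorem edgeSet_pathGraph {V : Type*} {l : List V} (hl : l.Nodup) :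
    (pathGraph l).edgeSet = {e | e ∈ edgeList l} := by
  rw [pathGraph, SimpleGraph.edgeSet_fromEdgeSet, sdiff_eq_left, Set.disjoint_left]
  exact fun e he => not_isDiag_of_mem_edgeList hl he

theorem pathGraph_adj {V : Type*} {l : List V} (hl : l.Nodup) {a b : V} :
    (pathGraph l).Adj a b ↔ s(a, b) ∈ edgeList l := by
  rw [← SimpleGraph.mem_edgeSet, edgeSet_pathGraph hl]
  rfl

/-- The list `L` runs through a plane spanning path from its free end to its fixed end `u`. -/
structure IsPlanePathTo {S : Finset Plane} (u : S) (L : List S) : Prop where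
  nodup : L.Nodup
  mem : ∀ v, v ∈ L
  getLast? : L.getLast? = some u
  plane : IsPlaneDrawing (pathGraph L)

theorem IsPlanePathTo.isSpanningPathFrom {S : Finset Plane} {u : S} {L : List S}
    (h : IsPlanePathTo u L) : IsSpanningPathFrom u (pathGraph L) := by
  classical
  obtain ⟨l, hl⟩ := List.getLast?_eq_some_iff.1 h.getLast?
  have hrev : u :: l.reverse = L.reverse := by simp [hl]
  have hchain : ∀ l' : List S, (∀ e ∈ edgeList l', e ∈ edgeList L) →
      l'.IsChain (pathGraph L).Adj := by
    intro l'
    induction l' with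
    | nil => simp
    | cons a t ih =>
      intro ht
      cases t with
      | nil => simp
      | cons b t =>
        rw [List.isChain_cons_cons]
        simp only [edgeList, List.mem_cons, forall_eq_or_imp] at ht
        exact ⟨(pathGraph_adj h.nodup).2 ht.1, ih ht.2⟩
  have hc : (u :: l.reverse).IsChain (pathGraph L).Adj := hchain _ (fun e he => by
    rwa [hrev, mem_edgeList_reverse] at he)
  obtain ⟨v, p, hp⟩ : ∃ (v : S) (p : (pathGraph L).Walk u v), p.support = L.reverse :=
    ⟨_, SimpleGraph.Walk.ofSupport (u :: l.reverse) (List.cons_ne_nil _ _) hc,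
      (SimpleGraph.Walk.support_ofSupport (List.cons_ne_nil _ _) hc).trans hrev⟩
  refine ⟨v, p, ?_, fun e he => ?_⟩
  · refine SimpleGraph.Walk.IsPath.isHamiltonian_of_mem (SimpleGraph.Walk.IsPath.mk' ?_) fun w => ?_
    · rw [hp]
      exact List.nodup_reverse.2 h.nodup
    · rw [hp, List.mem_reverse]
      exact h.mem w
  · rw [edgeSet_pathGraph h.nodup] at he
    rw [SimpleGraph.Walk.edges_eq_edgeList, hp, mem_edgeList_reverse]
    exact he

/-- The vertex of the flip graph given by a list. -/
def IsPlanePathTo.toPath {S : Finset Plane} {u : S} {L : List S} (h : IsPlanePathTo u L) :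
    PlaneSpanningPathFrom S u :=
  ⟨pathGraph L, h.isSpanningPathFrom, h.plane⟩

theorem IsPlanePathTo.exists_eq_toPath {S : Finset Plane} {u : S}
    (P : PlaneSpanningPathFrom S u) : ∃ L, ∃ h : IsPlanePathTo u L, h.toPath = P := by
  classical
  obtain ⟨G, ⟨v, p, hp, hpe⟩, hG⟩ := P
  have hnd : p.support.reverse.Nodup := List.nodup_reverse.2 hp.isPath.support_nodup
  have hgraph : pathGraph p.support.reverse = G := by
    rw [← SimpleGraph.edgeSet_inj, edgeSet_pathGraph hnd]
    ext e
    rw [Set.mem_ofPred_eq, mem_edgeList_reverse, ← SimpleGraph.Walk.edges_eq_edgeList]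
    exact ⟨fun h => p.edges_subset_edgeSet h, fun h => hpe e h⟩
  refine ⟨p.support.reverse, ⟨hnd, fun w => by simpa using hp.mem_support w, ?_, ?_⟩, ?_⟩
  · rw [List.getLast?_reverse, ← SimpleGraph.Walk.cons_tail_support]
    rfl
  · rwa [hgraph]
  · exact Subtype.ext hgraph

/-- The common last entry `u` removes the ambiguity of direction, so distinct lists are distinct
vertices of the flip graph. -/
theorem IsPlanePathTo.eq_of_toPath_eq {S : Finset Plane} {u : S} {L L' : List S}
    (h : IsPlanePathTo u L) (h' : IsPlanePathTo u L') (heq : h.toPath = h'.toPath) : L = L' := by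
  obtain ⟨l, rfl⟩ := List.getLast?_eq_some_iff.1 h.getLast?
  obtain ⟨l', rfl⟩ := List.getLast?_eq_some_iff.1 h'.getLast?
  have hn := List.nodup_reverse.2 h.nodup
  have hn' := List.nodup_reverse.2 h'.nodup
  have hg : pathGraph (l ++ [u]) = pathGraph (l' ++ [u]) := congrArg Subtype.val heq
  have he := congrArg SimpleGraph.edgeSet hg
  rw [edgeSet_pathGraph h.nodup, edgeSet_pathGraph h'.nodup] at he
  have key : l.reverse = l'.reverse := by
    refine eq_of_edgeList_eq (a := u) (by simpa using hn) (by simpa using hn') fun e => ?_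
    have h1 : u :: l.reverse = (l ++ [u]).reverse := by simp
    have h2 : u :: l'.reverse = (l' ++ [u]).reverse := by simp
    rw [h1, h2, mem_edgeList_reverse, mem_edgeList_reverse]
    exact Set.ext_iff.1 he e
  rw [List.reverse_injective key]

/-! ### Flips at the free end -/

theorem Crosses.ne {ε : ℝ} {p r c d : Plane} (h : Crosses ε p r c d) :
    c ≠ p ∧ c ≠ r ∧ d ≠ p ∧ d ≠ r := by
  obtain ⟨h1, h2, -, -⟩ := h
  refine ⟨?_, ?_, ?_, ?_⟩ <;> rintro rfl <;> simp_all [cr_self, cr_left, cr_right]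

theorem mem_edgeList_cons_append {V : Type*} {p q c : V} {A B : List V} {e : Sym2 V} :
    e ∈ edgeList (p :: A ++ q :: c :: B) ↔
      e ∈ edgeList (p :: A ++ [q]) ∨ e = s(q, c) ∨ e ∈ edgeList (c :: B) := by
  rw [edgeList_append, List.mem_append, List.mem_cons]

theorem mem_edgeList_flip {V : Type*} {p q c : V} {A B : List V} {e : Sym2 V} :
    e ∈ edgeList (q :: A.reverse ++ p :: c :: B) ↔
      e ∈ edgeList (p :: A ++ [q]) ∨ e = s(p, c) ∨ e ∈ edgeList (c :: B) := by
  rw [mem_edgeList_cons_append, ← mem_edgeList_reverse (l := p :: A ++ [q])]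
  simp

theorem nodup_flip {V : Type*} {p q c : V} {A B : List V}
    (h : (p :: A ++ q :: c :: B).Nodup) : (q :: A.reverse ++ p :: c :: B).Nodup := by
  refine (List.Perm.nodup_iff ?_).1 h
  have h1 : p :: A ++ q :: c :: B = (p :: A ++ [q]) ++ c :: B := by simp
  have h2 : q :: A.reverse ++ p :: c :: B = (p :: A ++ [q]).reverse ++ c :: B := by simp
  rw [h1, h2]
  exact (List.reverse_perm _).symm.append_right _

/-- The only new edge is `pc`, and visibility says that no old edge crosses it. -/
theorem isPlanePathTo_flip {S : Finset Plane} (hS : InGeneralPosition S) {u p q c : S}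
    {A B : List S} (h : IsPlanePathTo u (p :: A ++ q :: c :: B))
    (hs : Sees (pathGraph (p :: A ++ q :: c :: B)) p c) :
    IsPlanePathTo u (q :: A.reverse ++ p :: c :: B) := by
  have hnd := nodup_flip h.nodup
  have hpc : p ≠ c := by
    rintro rfl
    simpa using h.nodup
  have hnc : ∀ x y, s(x, y) ∈ edgeList (p :: A ++ q :: c :: B) →
      ¬ CrossesPair (p : Plane) c x y := by
    intro x y hxy hcr
    rcases hcr with hcr | hcr
    · exact hs x y ((pathGraph_adj h.nodup).2 hxy) hcr
    · exact hs y x ((pathGraph_adj h.nodup).2 hxy).symm hcr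
  have hold : ∀ x y, s(x, y) ∈ edgeList (q :: A.reverse ++ p :: c :: B) →
      s(x, y) = s(p, c) ∨ s(x, y) ∈ edgeList (p :: A ++ q :: c :: B) := by
    intro x y hxy
    rw [mem_edgeList_flip] at hxy
    rw [mem_edgeList_cons_append]
    tauto
  have hnew : ∀ x y, s(x, y) ∈ edgeList (p :: A ++ q :: c :: B) → s(p, c) ≠ s(x, y) →
      segment ℝ (p : Plane) c ∩ segment ℝ (x : Plane) y ⊆
      ({(p : Plane), (c : Plane)} ∩ {(x : Plane), (y : Plane)} : Set Plane) := fun x y hxy hne =>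
    segment_inter_of_not_crossesPair hS hpc ((pathGraph_adj h.nodup).2 hxy).ne hne (hnc x y hxy)
  refine ⟨hnd, fun v => ?_, ?_, ?_⟩
  · have := h.mem v
    simp only [List.cons_append, List.mem_cons, List.mem_append, List.mem_reverse] at this ⊢
    tauto
  · have := h.getLast?
    simpa [List.getLast?_append, List.getLast?_cons] using this
  · intro a b x y hab hxy hne
    rw [pathGraph_adj hnd] at hab hxy
    rcases hold a b hab with hab' | hab' <;> rcases hold x y hxy with hxy' | hxy'
    · exact absurd (hab'.trans hxy'.symm) hne
    · have := hnew x y hxy' (hab' ▸ hne)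
      rcases Sym2.eq_iff.1 hab' with ⟨rfl, rfl⟩ | ⟨rfl, rfl⟩
      · exact this
      · rwa [segment_symm, Set.pair_comm]
    · have := hnew a b hab' (hxy' ▸ hne.symm)
      rw [Set.inter_comm, Set.inter_comm {(a : Plane), (b : Plane)}]
      rcases Sym2.eq_iff.1 hxy' with ⟨rfl, rfl⟩ | ⟨rfl, rfl⟩
      · exact this
      · rwa [segment_symm, Set.pair_comm]
    · exact h.plane a b x y ((pathGraph_adj h.nodup).2 hab') ((pathGraph_adj h.nodup).2 hxy') hne

theorem isFlip_pathGraph {V : Type*} {p q c : V} {A B : List V}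
    (h : (p :: A ++ q :: c :: B).Nodup) :
    IsFlip (pathGraph (p :: A ++ q :: c :: B)) (pathGraph (q :: A.reverse ++ p :: c :: B)) := by
  refine ⟨s(q, c), ?_, s(p, c), ?_, ?_⟩
  · rw [edgeSet_pathGraph h, Set.mem_ofPred_eq, mem_edgeList_cons_append]
    tauto
  · rw [edgeSet_pathGraph (nodup_flip h), Set.mem_ofPred_eq, mem_edgeList_flip]
    tauto
  · rw [edgeSet_pathGraph h, edgeSet_pathGraph (nodup_flip h)]
    ext e
    simp only [Set.mem_union, Set.mem_sdiff, Set.mem_ofPred_eq, Set.mem_singleton_iff]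
    rw [mem_edgeList_flip, mem_edgeList_cons_append]
    have h1 : s(q, c) ∉ edgeList (p :: A ++ [q]) := by
      intro hm
      have := mem_of_mem_edgeList (Sym2.mem_mk_right q c) hm
      simp [List.nodup_append] at h this
      grind
    have h2 : s(q, c) ∉ edgeList (c :: B) := by
      intro hm
      have := mem_of_mem_edgeList (Sym2.mem_mk_left q c) hm
      simp [List.nodup_append] at h this
      grind
    constructor
    · rintro (he | he | he)
      · exact Or.inl ⟨Or.inl he, fun h => h1 (h ▸ he)⟩
      · exact Or.inr he
      · exact Or.inl ⟨Or.inr (Or.inr he), fun h => h2 (h ▸ he)⟩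
    · tauto

/-! ### Combinatorics of prefix reversals -/

/-- Reverse the first `k` entries of a list. -/
def prefixReverse {V : Type*} (k : ℕ) (L : List V) : List V := (L.take k).reverse ++ L.drop k

theorem length_prefixReverse {V : Type*} (k : ℕ) (L : List V) :
    (prefixReverse k L).length = L.length := by
  simp [prefixReverse]; omega

theorem getElem?_prefixReverse {V : Type*} {k : ℕ} {L : List V} (hk : k ≤ L.length) (t : ℕ) :
    (prefixReverse k L)[t]? = L[if t < k then k - 1 - t else t]? := by
  unfold prefixReverse
  split_ifs with h
  · rw [List.getElem?_append_left (by simp; omega), List.getElem?_reverse (by simp; omega),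
      List.getElem?_take_of_lt (by simp; omega)]
    congr 1
    simp
    omega
  · rw [List.getElem?_append_right (by simp; omega), List.getElem?_drop]
    congr 1
    simp
    omega

theorem prefixReverse_prefixReverse {V : Type*} {k : ℕ} {L : List V} (hk : k ≤ L.length) :
    prefixReverse k (prefixReverse k L) = L := by
  refine List.ext_getElem? fun t => ?_
  rw [getElem?_prefixReverse (by rwa [length_prefixReverse]), getElem?_prefixReverse hk]
  congr 1
  split_ifs <;> omega

theorem prefixReverse_one {V : Type*} (L : List V) : prefixReverse 1 L = L := by
  cases L <;> simp [prefixReverse]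

/-- For `i ≥ 2`, position `max i k - 1` is the last one whose entry changes, so the result
determines `max i k`; the entry found there then determines `i`. -/
theorem getElem?_prefixReverse_prefixReverse {V : Type*} {L : List V} {i k : ℕ}
    (hi : 1 ≤ i) (hi' : i ≤ L.length) (hk : 1 ≤ k) (hk' : k ≤ L.length) (hki : k ≠ i) :
    (∀ t, max i k ≤ t → (prefixReverse k (prefixReverse i L))[t]? = L[t]?) ∧
      (prefixReverse k (prefixReverse i L))[max i k - 1]? = L[if k < i then 0 else i - 1]? := by
  refine ⟨fun t ht => ?_, ?_⟩
  · rw [getElem?_prefixReverse (by rwa [length_prefixReverse]), getElem?_prefixReverse hi',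
      if_neg (show ¬ t < k by omega), if_neg (show ¬ t < i by omega)]
  · rw [getElem?_prefixReverse (by rwa [length_prefixReverse]), getElem?_prefixReverse hi']
    congr 1
    rcases lt_or_gt_of_ne hki with h | h
    · rw [if_pos h, max_eq_left h.le, if_neg (show ¬ i - 1 < k by omega),
        if_pos (show i - 1 < i by omega)]
      omega
    · rw [if_neg (show ¬ k < i by omega), max_eq_right h.le, if_pos (show k - 1 < k by omega),
        if_pos (show k - 1 - (k - 1) < i by omega)]
      omega

/-- There are no triangles and no quadrilaterals of prefix reversals. -/
theorem eq_of_prefixReverse_eq {V : Type*} {L : List V} (hL : L.Nodup) {i j k l : ℕ}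
    (hi : 2 ≤ i) (hi' : i ≤ L.length) (hj : 2 ≤ j) (hj' : j ≤ L.length) (hk : 1 ≤ k)
    (hk' : k ≤ L.length) (hl : 1 ≤ l) (hl' : l ≤ L.length) (hki : k ≠ i) (hlj : l ≠ j)
    (h : prefixReverse k (prefixReverse i L) = prefixReverse l (prefixReverse j L)) : i = j := by
  obtain ⟨a1, a2⟩ := getElem?_prefixReverse_prefixReverse (by omega) hi' hk hk' hki
  obtain ⟨b1, b2⟩ := getElem?_prefixReverse_prefixReverse (by omega) hj' hl hl' hlj
  rw [h] at a1 a2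
  rcases lt_trichotomy (max i k) (max j l) with hm | hm | hm
  · have := (List.getElem?_inj (by omega) hL).1 ((a1 (max j l - 1) (by omega)).symm.trans b2)
    split_ifs at this <;> omega
  · rw [hm] at a2
    have := (List.getElem?_inj (by split_ifs <;> omega) hL).1 (a2.symm.trans b2)
    split_ifs at this <;> omega
  · have := (List.getElem?_inj (by omega) hL).1 ((b1 (max i k - 1) (by omega)).symm.trans a2)
    split_ifs at this <;> omega

theorem prefixReverse_inj {V : Type*} {L : List V} (hL : L.Nodup) {i j : ℕ}
    (hi : 1 ≤ i) (hi' : i ≤ L.length) (hj : 1 ≤ j) (hj' : j ≤ L.length)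
    (h : prefixReverse i L = prefixReverse j L) : i = j := by
  have key : ∀ t, t < L.length →
      (if t < i then i - 1 - t else t) = (if t < j then j - 1 - t else t) := by
    intro t ht
    have h1 := congrArg (fun M => M[t]?) h
    beta_reduce at h1
    rw [getElem?_prefixReverse hi', getElem?_prefixReverse hj'] at h1
    refine (List.getElem?_inj ?_ hL).1 h1
    split_ifs <;> omega
  have k1 := key 0 (by omega)
  split_ifs at k1 <;> omega

theorem prefixReverse_ne_self {V : Type*} {L : List V} (hL : L.Nodup) {i : ℕ}
    (hi : 2 ≤ i) (hi' : i ≤ L.length) : prefixReverse i L ≠ L := by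
  intro he
  nth_rw 2 [← prefixReverse_one L] at he
  have := prefixReverse_inj hL (by omega) hi' (by omega) (by omega) he
  omega

theorem nodup_prefixReverse {V : Type*} {L : List V} (hL : L.Nodup) (k : ℕ) :
    (prefixReverse k L).Nodup := by
  refine (List.Perm.nodup_iff ?_).1 hL
  nth_rw 1 [← List.take_append_drop k L]
  exact (List.reverse_perm _).symm.append_right _

theorem prefixReverse_prefixReverse_ne_self {V : Type*} {L : List V} (hL : L.Nodup) {i k : ℕ}
    (hi : 1 ≤ i) (hi' : i ≤ L.length) (hk : 1 ≤ k) (hk' : k ≤ L.length) (hki : k ≠ i) :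
    prefixReverse k (prefixReverse i L) ≠ L := by
  intro he
  have hlen := length_prefixReverse i L
  exact hki (prefixReverse_inj (nodup_prefixReverse hL i) hk (by omega) hi (by omega)
    (he.trans (prefixReverse_prefixReverse hi').symm))

theorem prefixReverse_prefixReverse_ne {V : Type*} {L : List V} (hL : L.Nodup) {i j k : ℕ}
    (hi : 2 ≤ i) (hi' : i ≤ L.length) (hj : 2 ≤ j) (hj' : j ≤ L.length) (hk : 2 ≤ k)
    (hk' : k ≤ L.length) (hki : k ≠ i) :
    prefixReverse k (prefixReverse i L) ≠ prefixReverse j L := by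
  by_cases hij : i = j
  · subst hij
    exact prefixReverse_ne_self (nodup_prefixReverse hL i) hk (by rwa [length_prefixReverse])
  · intro he
    -- Reversing one entry does nothing, so a triangle is a degenerate quadrilateral.
    rw [← prefixReverse_one (prefixReverse j L)] at he
    exact hij (eq_of_prefixReverse_eq hL hi hi' hj hj' (by omega) hk' le_rfl (by omega) hki
      (by omega) he)

/-! ### Flips given by visibility -/

/-- The free end of `L` sees the `k`-th point, so that reversing the first `k` points is a flip. -/
def SeesAt {S : Finset Plane} (L : List S) (k : ℕ) : Prop :=
  2 ≤ k ∧ ∃ p c, L[0]? = some p ∧ L[k]? = some c ∧ Sees (pathGraph L) p c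

theorem SeesAt.lt {S : Finset Plane} {L : List S} {k : ℕ} (h : SeesAt L k) : k < L.length := by
  obtain ⟨-, p, c, -, hc, -⟩ := h
  by_contra hk
  rw [List.getElem?_eq_none (by omega)] at hc
  cases hc

theorem SeesAt.exists_eq {S : Finset Plane} {L : List S} {k : ℕ} (h : SeesAt L k) :
    ∃ p A q c B, L = p :: A ++ q :: c :: B ∧ A.length + 2 = k ∧ Sees (pathGraph L) p c ∧
      prefixReverse k L = q :: A.reverse ++ p :: c :: B := by
  have hlt := h.lt
  obtain ⟨hk, p, c, hp, hc, hs⟩ := h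
  obtain ⟨hk', hc'⟩ := List.getElem?_eq_some_iff.1 hc
  obtain ⟨p', L', rfl⟩ : ∃ p' L', L = p' :: L' := by
    cases L with
    | nil => simp at hlt
    | cons p' L' => exact ⟨p', L', rfl⟩
  obtain rfl : p' = p := by simpa using hp
  have hq : k - 2 < L'.length := by simp at hlt; omega
  have hL : p' :: L' = p' :: L'.take (k - 2) ++ L'[k - 2] :: c :: (p' :: L').drop (k + 1) := by
    have h1 : L'.take (k - 2) ++ L'[k - 2] :: L'.drop (k - 1) = L' := by
      have : k - 1 = k - 2 + 1 := by omega
      rw [this, ← List.drop_eq_getElem_cons, List.take_append_drop]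
    have h2 : L'.drop (k - 1) = c :: (p' :: L').drop (k + 1) := by
      rw [← hc', ← List.drop_eq_getElem_cons]
      obtain ⟨k, rfl⟩ : ∃ k', k = k' + 1 := ⟨k - 1, by omega⟩
      simp
    rw [← h2, List.cons_append, h1]
  refine ⟨p', L'.take (k - 2), L'[k - 2], c, (p' :: L').drop (k + 1), hL, ?_, hs, ?_⟩
  · simp; omega
  · have hlen : (p' :: L'.take (k - 2) ++ [L'[k - 2]]).length = k := by simp; omega
    have h3 : p' :: L' = (p' :: L'.take (k - 2) ++ [L'[k - 2]]) ++ c :: (p' :: L').drop (k + 1) := by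
      simpa only [List.cons_append, List.append_assoc, List.nil_append] using hL
    unfold prefixReverse
    generalize (p' :: L').drop (k + 1) = B at *
    rw [h3, List.take_left' hlen, List.drop_left' hlen]
    generalize L'.take (k - 2) = A
    generalize L'[k - 2] = q
    simp

theorem SeesAt.isPlanePathTo {S : Finset Plane} (hS : InGeneralPosition S) {u : S} {L : List S}
    {k : ℕ} (hk : SeesAt L k) (hL : IsPlanePathTo u L) : IsPlanePathTo u (prefixReverse k L) := by
  obtain ⟨p, A, q, c, B, rfl, -, hs, heq⟩ := hk.exists_eq
  rw [heq]
  exact isPlanePathTo_flip hS hL hs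

theorem SeesAt.isFlip {S : Finset Plane} {u : S} {L : List S}
    {k : ℕ} (hk : SeesAt L k) (hL : IsPlanePathTo u L) :
    IsFlip (pathGraph L) (pathGraph (prefixReverse k L)) := by
  obtain ⟨p, A, q, c, B, rfl, -, hs, heq⟩ := hk.exists_eq
  rw [heq]
  exact isFlip_pathGraph hL.nodup

/-- The way back is open: `qc` was an edge of the plane path, so no old edge crosses it, and the new
edge `pc` shares the end `c`. -/
theorem SeesAt.symm {S : Finset Plane} (hS : InGeneralPosition S) {u : S} {L : List S}
    {k : ℕ} (hk : SeesAt L k) (hL : IsPlanePathTo u L) : SeesAt (prefixReverse k L) k := by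
  have hM := hk.isPlanePathTo hS hL
  obtain ⟨p, A, q, c, B, rfl, hlen, hs, heq⟩ := hk.exists_eq
  rw [heq] at hM ⊢
  refine ⟨hk.1, q, c, rfl, ?_, ?_⟩
  · subst hlen
    simp
  · intro x y hxy hcr
    rw [pathGraph_adj hM.nodup, mem_edgeList_flip] at hxy
    obtain ⟨n1, n2, n3, n4⟩ := hcr.ne
    have hqc : s(q, c) ∈ edgeList (p :: A ++ q :: c :: B) := by
      rw [mem_edgeList_cons_append]; tauto
    by_cases hpc : s(x, y) = s(p, c)
    · rcases Sym2.eq_iff.1 hpc with ⟨rfl, rfl⟩ | ⟨rfl, rfl⟩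
      · exact n4 rfl
      · exact n2 rfl
    · have hxy' : s(x, y) ∈ edgeList (p :: A ++ q :: c :: B) := by
        rw [mem_edgeList_cons_append]; tauto
      refine hL.plane.not_crossesPair ((pathGraph_adj hL.nodup).2 hqc)
        ((pathGraph_adj hL.nodup).2 hxy') ?_ ?_ ?_ ?_ (Or.inl hcr) <;> rintro rfl <;> contradiction

theorem exists_seesAt_of_sees {S : Finset Plane} {u : S} {p a v : S} {L : List S}
    (hL : IsPlanePathTo u (p :: a :: L)) (hvp : v ≠ p) (hva : v ≠ a)
    (hs : Sees (pathGraph (p :: a :: L)) p v) :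
    ∃ k, (p :: a :: L)[k]? = some v ∧ SeesAt (p :: a :: L) k := by
  obtain ⟨k, hk⟩ := List.mem_iff_getElem?.1 (hL.mem v)
  refine ⟨k, hk, ?_, p, v, rfl, hk, hs⟩
  by_contra hk2
  have : k = 0 ∨ k = 1 := by omega
  rcases this with rfl | rfl
  · exact hvp (by simpa using hk.symm)
  · exact hva (by simpa using hk.symm)

/-! ### Five paths in a component -/

/-- The path `L` represents a vertex of the component `C`. -/
def InComponent {S : Finset Plane} {u : S} (C : (fixedEndpointFlipGraph S u).ConnectedComponent)
    (L : List S) : Prop :=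
  ∃ h : IsPlanePathTo u L, (fixedEndpointFlipGraph S u).connectedComponentMk h.toPath = C

section component

variable {S : Finset Plane} {u : S} {C : (fixedEndpointFlipGraph S u).ConnectedComponent}
  {L : List S}

theorem InComponent.prefixReverse (hS : InGeneralPosition S) (h : InComponent C L) {k : ℕ}
    (hk : SeesAt L k) : InComponent C (prefixReverse k L) := by
  obtain ⟨hL, rfl⟩ := h
  refine ⟨hk.isPlanePathTo hS hL, ?_⟩
  by_cases heq : (hk.isPlanePathTo hS hL).toPath = hL.toPath
  · rw [heq]
  · refine SimpleGraph.ConnectedComponent.sound (SimpleGraph.Adj.reachable ?_)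
    exact (SimpleGraph.fromRel_adj _ _ _).2 ⟨heq, Or.inr (hk.isFlip hL)⟩

theorem four_lt_ncard_of_nodup (l : List (List S)) (hl : l.Nodup) (hlen : l.length = 5)
    (h : ∀ L ∈ l, InComponent C L) : 4 < C.supp.ncard := by
  classical
  -- Needed because `Set.ncard` is 0 on infinite sets.
  have hfin : Finite (PlaneSpanningPathFrom S u) := Subtype.finite
  let f : {L : List S // L ∈ l} → PlaneSpanningPathFrom S u := fun L => (h L L.2).choose.toPath
  have hf : Function.Injective f := fun L L' hLL' =>
    Subtype.ext (IsPlanePathTo.eq_of_toPath_eq _ _ hLL')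
  have hnd : (l.attach.map f).Nodup := (List.nodup_attach.2 hl).map hf
  have hsub : ((l.attach.map f).toFinset : Set (PlaneSpanningPathFrom S u)) ⊆ C.supp := by
    intro P hP
    simp only [List.coe_toFinset, List.mem_map, Set.mem_ofPred_eq] at hP
    obtain ⟨L, -, rfl⟩ := hP
    exact (h L L.2).choose_spec
  have := Set.ncard_le_ncard hsub (Set.toFinite _)
  rw [Set.ncard_coe_finset, List.toFinset_card_of_nodup hnd] at this
  simp at this
  omega

theorem IsPlanePathTo.length_eq (hL : IsPlanePathTo u L) : L.length = S.card := by
  classical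
  have h : L.toFinset = Finset.univ := by
    ext v
    simpa using hL.mem v
  rw [← List.toFinset_card_of_nodup hL.nodup, h, Finset.card_univ, Fintype.card_coe]

/-- A star with three rays, one of them prolonged; its vertices are distinct since there are no
triangles. -/
theorem four_lt_ncard_of_three_seesAt (hS : InGeneralPosition S) (h : InComponent C L)
    {i₁ i₂ i₃ k : ℕ} (h₁ : SeesAt L i₁) (h₂ : SeesAt L i₂) (h₃ : SeesAt L i₃) (h₁₂ : i₁ ≠ i₂)
    (h₁₃ : i₁ ≠ i₃) (h₂₃ : i₂ ≠ i₃) (hk : SeesAt (prefixReverse i₂ L) k) (hki : k ≠ i₂) :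
    4 < C.supp.ncard := by
  have hnd := h.choose.nodup
  have lk : k ≤ L.length := by simpa [length_prefixReverse] using hk.lt.le
  have hself : ∀ i, SeesAt L i → L ≠ prefixReverse i L := fun i hi =>
    (prefixReverse_ne_self hnd hi.1 hi.lt.le).symm
  have hinj : ∀ i j, SeesAt L i → SeesAt L j → i ≠ j → prefixReverse i L ≠ prefixReverse j L :=
    fun i j hi hj hij he => hij (prefixReverse_inj hnd (one_le_two.trans hi.1) hi.lt.le
      (one_le_two.trans hj.1) hj.lt.le he)
  have htri : ∀ i, SeesAt L i → prefixReverse i L ≠ prefixReverse k (prefixReverse i₂ L) :=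
    fun i hi => (prefixReverse_prefixReverse_ne hnd h₂.1 h₂.lt.le hi.1 hi.lt.le hk.1 lk hki).symm
  have hback := (prefixReverse_prefixReverse_ne_self hnd (one_le_two.trans h₂.1) h₂.lt.le
    (one_le_two.trans hk.1) lk hki).symm
  refine four_lt_ncard_of_nodup (C := C) [L, prefixReverse i₁ L, prefixReverse i₂ L,
    prefixReverse i₃ L, prefixReverse k (prefixReverse i₂ L)] ?_ rfl ?_
  · simp only [List.nodup_cons, List.mem_cons, List.not_mem_nil, or_false, not_or,
      not_false_eq_true, List.nodup_nil, and_true]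
    exact ⟨⟨hself _ h₁, hself _ h₂, hself _ h₃, hback⟩,
      ⟨hinj _ _ h₁ h₂ h₁₂, hinj _ _ h₁ h₃ h₁₃, htri _ h₁⟩,
      ⟨hinj _ _ h₂ h₃ h₂₃, htri _ h₂⟩, htri _ h₃⟩
  · simp only [List.mem_cons, List.not_mem_nil, or_false, forall_eq_or_imp, forall_eq]
    exact ⟨h, h.prefixReverse hS h₁, h.prefixReverse hS h₂, h.prefixReverse hS h₃,
      (h.prefixReverse hS h₂).prefixReverse hS hk⟩

/-- Two steps in two directions from `L`; the outer ends differ since there are no quadrilaterals.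
-/
theorem four_lt_ncard_of_two_seesAt (hS : InGeneralPosition S) (h : InComponent C L)
    {i j k l : ℕ} (hi : SeesAt L i) (hj : SeesAt L j) (hij : i ≠ j)
    (hk : SeesAt (prefixReverse i L) k) (hki : k ≠ i)
    (hl : SeesAt (prefixReverse j L) l) (hlj : l ≠ j) : 4 < C.supp.ncard := by
  have hnd := h.choose.nodup
  have lk : k ≤ L.length := by simpa [length_prefixReverse] using hk.lt.le
  have ll : l ≤ L.length := by simpa [length_prefixReverse] using hl.lt.le
  have i1 := one_le_two.trans hi.1
  have j1 := one_le_two.trans hj.1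
  have k1 := one_le_two.trans hk.1
  have l1 := one_le_two.trans hl.1
  refine four_lt_ncard_of_nodup (C := C) [L, prefixReverse i L, prefixReverse j L,
    prefixReverse k (prefixReverse i L), prefixReverse l (prefixReverse j L)] ?_ rfl ?_
  · simp only [List.nodup_cons, List.mem_cons, List.not_mem_nil, or_false, not_or,
      not_false_eq_true, List.nodup_nil, and_true]
    exact ⟨⟨(prefixReverse_ne_self hnd hi.1 hi.lt.le).symm,
      (prefixReverse_ne_self hnd hj.1 hj.lt.le).symm,
      (prefixReverse_prefixReverse_ne_self hnd i1 hi.lt.le k1 lk hki).symm,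
      (prefixReverse_prefixReverse_ne_self hnd j1 hj.lt.le l1 ll hlj).symm⟩,
      ⟨fun he => hij (prefixReverse_inj hnd i1 hi.lt.le j1 hj.lt.le he),
      (prefixReverse_prefixReverse_ne hnd hi.1 hi.lt.le hi.1 hi.lt.le hk.1 lk hki).symm,
      (prefixReverse_prefixReverse_ne hnd hj.1 hj.lt.le hi.1 hi.lt.le hl.1 ll hlj).symm⟩,
      ⟨(prefixReverse_prefixReverse_ne hnd hi.1 hi.lt.le hj.1 hj.lt.le hk.1 lk hki).symm,
      (prefixReverse_prefixReverse_ne hnd hj.1 hj.lt.le hj.1 hj.lt.le hl.1 ll hlj).symm⟩,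
      fun he => hij (eq_of_prefixReverse_eq hnd hi.1 hi.lt.le hj.1 hj.lt.le k1 lk l1 ll hki hlj he)⟩
  · simp only [List.mem_cons, List.not_mem_nil, or_false, forall_eq_or_imp, forall_eq]
    exact ⟨h, h.prefixReverse hS hi, h.prefixReverse hS hj,
      (h.prefixReverse hS hi).prefixReverse hS hk, (h.prefixReverse hS hj).prefixReverse hS hl⟩

end component

/-! ### Paths with few flips -/

theorem eq_or_eq_of_pathGraph_adj_second {V : Type*} {p a b v : V} {T : List V}
    (h : (p :: a :: b :: T).Nodup) (hadj : (pathGraph (p :: a :: b :: T)).Adj a v) :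
    v = p ∨ v = b := by
  rw [pathGraph_adj h] at hadj
  simp only [edgeList, List.mem_cons] at hadj
  simp only [List.nodup_cons, List.mem_cons, not_or] at h
  rcases hadj with he | he | he
  · rcases Sym2.eq_iff.1 he with ⟨h1, h2⟩ | ⟨h1, h2⟩
    · exact absurd h1.symm h.1.1
    · exact Or.inl h2
  · rcases Sym2.eq_iff.1 he with ⟨h1, h2⟩ | ⟨h1, h2⟩
    · exact Or.inr h2
    · exact absurd h1 h.2.1.1
  · have := mem_of_mem_edgeList (Sym2.mem_mk_left a v) he
    simp only [List.mem_cons] at this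
    rcases this with h1 | h1
    · exact absurd h1 h.2.1.1
    · exact absurd h1 h.2.1.2

theorem eq_or_eq_of_pathGraph_adj_third {V : Type*} {q p a b v : V} {T : List V}
    (h : (q :: p :: a :: b :: T).Nodup) (hadj : (pathGraph (q :: p :: a :: b :: T)).Adj a v) :
    v = p ∨ v = b := by
  refine eq_or_eq_of_pathGraph_adj_second h.of_cons ?_
  rw [pathGraph_adj h, edgeList, List.mem_cons] at hadj
  rw [pathGraph_adj h.of_cons]
  rcases hadj with he | he
  · simp only [List.nodup_cons, List.mem_cons, not_or] at h
    rcases Sym2.eq_iff.1 he with ⟨h1, -⟩ | ⟨h1, -⟩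
    · exact absurd h1.symm h.1.2.1
    · exact absurd h1.symm h.2.1.1
  · exact he

section

variable {S : Finset Plane} {u : S} {L : List S}

theorem IsPlanePathTo.exists_eq_cons (hL : IsPlanePathTo u L) (hcard : 5 ≤ S.card) :
    ∃ p a b x y T, L = p :: a :: b :: x :: y :: T := by
  rw [← hL.length_eq] at hcard
  match L, hcard with
  | p :: a :: b :: x :: y :: T, _ => exact ⟨p, a, b, x, y, T, rfl⟩

theorem exists_seesAt (hS : InGeneralPosition S) (hcard : 5 ≤ S.card) (hL : IsPlanePathTo u L) :
    ∃ k, SeesAt L k := by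
  obtain ⟨p, a, b, x, y, T, rfl⟩ := hL.exists_eq_cons hcard
  have hnd := hL.nodup
  simp only [List.nodup_cons, List.mem_cons, not_or] at hnd
  obtain ⟨v, h1, h2, h3⟩ := exists_sees_ne hS hL.plane (p := p) (a := a) (r := b)
    (fun h => hnd.1.2.1 h.symm) (fun h => hnd.2.1.1 h.symm)
  obtain ⟨k, -, hk⟩ := exists_seesAt_of_sees hL h1 h2 h3
  exact ⟨k, hk⟩

/-- If only one flip is possible, then the free end is cut off by an edge between its
neighbour and the next point. -/
theorem eq_two_of_seesAt_unique (hS : InGeneralPosition S) {p a b x : S} {T : List S}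
    (hL : IsPlanePathTo u (p :: a :: b :: x :: T)) {k : ℕ}
    (hk : SeesAt (p :: a :: b :: x :: T) k)
    (huniq : ∀ j, SeesAt (p :: a :: b :: x :: T) j → j = k) :
    k = 2 ∧ ∀ r : S, r ≠ p → r ≠ a → r ≠ b → CrossesPair (p : Plane) r a b := by
  have hk2 := hk.1
  have hlt := hk.lt
  obtain ⟨-, p', c, hp', hc, hs⟩ := id hk
  have hvis : ∀ r, r ≠ p → Sees (pathGraph (p :: a :: b :: x :: T)) p r → r = a ∨ r = c := by
    intro r hr hsr
    by_cases hra : r = a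
    · exact Or.inl hra
    · obtain ⟨j, hj, hj'⟩ := exists_seesAt_of_sees hL hr hra hsr
      obtain rfl := huniq j hj'
      rw [hc] at hj
      exact Or.inr (by simpa using hj.symm)
  have hnd := hL.nodup
  simp only [List.nodup_cons, List.mem_cons, not_or] at hnd
  -- Otherwise `b` is hidden, so `ac` is an edge; but the path neighbours of `a` are `p` and `b`.
  have hcb : c = b := by
    by_contra hcb
    have hadj := (crossesPair_of_sees_only hS hL.plane hvis (r := b) (fun h => hnd.1.2.1 h.symm)
      (fun h => hnd.2.1.1 h.symm) (fun h => hcb h.symm)).1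
    rcases eq_or_eq_of_pathGraph_adj_second hL.nodup hadj with rfl | h
    · have := (List.getElem?_inj (j := 0) hlt hL.nodup).1 (by rw [hc]; rfl)
      omega
    · exact hcb h
  subst hcb
  refine ⟨?_, fun r h1 h2 h3 => (crossesPair_of_sees_only hS hL.plane hvis h1 h2 h3).2⟩
  exact (List.getElem?_inj (j := 2) hlt hL.nodup).1 (by rw [hc]; rfl)

theorem exists_seesAt_ne_of_three_le (hS : InGeneralPosition S) (hcard : 5 ≤ S.card)
    (hL : IsPlanePathTo u L) {k : ℕ} (hk : SeesAt L k) (hk3 : 3 ≤ k) :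
    ∃ j, SeesAt L j ∧ j ≠ k := by
  by_contra! h
  obtain ⟨p, a, b, x, y, T, rfl⟩ := hL.exists_eq_cons hcard
  have := (eq_two_of_seesAt_unique hS hL hk h).1
  omega

/-- If both paths had a single flip, `ab` would cross `px` and `pb` would cross `ax`. -/
theorem exists_seesAt_prefixReverse_two (hS : InGeneralPosition S) {p a b x : S} {T : List S}
    (hL : IsPlanePathTo u (p :: a :: b :: x :: T)) (hk : SeesAt (p :: a :: b :: x :: T) 2)
    (hD : ∀ r : S, r ≠ p → r ≠ a → r ≠ b → CrossesPair (p : Plane) r a b) :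
    ∃ j, SeesAt (a :: p :: b :: x :: T) j ∧ j ≠ 2 := by
  by_contra! h
  have hk' : SeesAt (a :: p :: b :: x :: T) 2 := hk.symm hS hL
  have hL' : IsPlanePathTo u (a :: p :: b :: x :: T) := hk.isPlanePathTo hS hL
  have hD' := (eq_two_of_seesAt_unique hS hL' hk' h).2
  have hnd := hL.nodup
  simp only [List.nodup_cons, List.mem_cons, not_or] at hnd
  have hxp : x ≠ p := fun h => hnd.1.2.2.1 h.symm
  have hxa : x ≠ a := fun h => hnd.2.1.2.1 h.symm
  have hxb : x ≠ b := fun h => hnd.2.2.1.1 h.symm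
  exact (hD x hxp hxa hxb).false_of_swap (hD' x hxa hxp hxb)

/-- If `p :: a :: b :: …` allows only one flip, and the path `a :: p :: b :: …` that it leads to
only two, then the path that the second of those leads to allows at least three. -/
theorem exists_seesAt_of_two_flips (hS : InGeneralPosition S) {p a b x y : S} {T : List S}
    (hL : IsPlanePathTo u (p :: a :: b :: x :: y :: T))
    (hD : ∀ r : S, r ≠ p → r ≠ a → r ≠ b → CrossesPair (p : Plane) r a b)
    (hL' : IsPlanePathTo u (a :: p :: b :: x :: y :: T)) {j : ℕ}
    (hj : SeesAt (a :: p :: b :: x :: y :: T) j) (hj2 : j ≠ 2)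
    (honly : ∀ i, SeesAt (a :: p :: b :: x :: y :: T) i → i = 2 ∨ i = j) :
    j = 3 ∧ SeesAt (b :: p :: a :: x :: y :: T) 2 ∧
      ∃ i, SeesAt (b :: p :: a :: x :: y :: T) i ∧ i ≠ 2 ∧ i ≠ 3 := by
  have hnd := hL.nodup
  simp only [List.nodup_cons, List.mem_cons, not_or] at hnd
  obtain ⟨⟨hpa, hpb, hpx, hpy, -⟩, ⟨hab, hax, hay, -⟩, ⟨hbx, hby, hbT⟩, ⟨hxy, -⟩, -⟩ := hnd
  have hjlt := hj.lt
  have hj2' := hj.1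
  obtain ⟨-, a', c, ha', hc, hs⟩ := id hj
  have hindex : ∀ (i : ℕ) (v : S), (a :: p :: b :: x :: y :: T)[i]? = some v → c = v → j = i :=
    fun i v hi hcv => (List.getElem?_inj hjlt hL'.nodup).1 (hc.trans (by rw [hi, hcv]))
  have hcp : c ≠ p := fun h => by have := hindex 1 p rfl h; omega
  have hcb : c ≠ b := fun h => by have := hindex 2 b rfl h; omega
  have hca : c ≠ a := fun h => by have := hindex 0 a rfl h; omega
  have hvis : ∀ r, r ≠ a → Sees (pathGraph (a :: p :: b :: x :: y :: T)) a r →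
      r = p ∨ r = b ∨ r = c := by
    intro r hr hsr
    by_cases hrp : r = p
    · exact Or.inl hrp
    · obtain ⟨i, hi, hi'⟩ := exists_seesAt_of_sees hL' hr hrp hsr
      rcases honly i hi' with rfl | rfl
      · exact Or.inr (Or.inl (by simpa using hi.symm))
      · rw [hc] at hi
        exact Or.inr (Or.inr (by simpa using hi.symm))
  have hpc : ¬ (pathGraph (a :: p :: b :: x :: y :: T)).Adj p c := fun h => by
    rcases eq_or_eq_of_pathGraph_adj_second hL'.nodup h with h | h
    · exact hca h
    · exact hcb h
  have key : ∀ z, z ≠ p → z ≠ a → z ≠ b → z ≠ c → _ := fun z h1 h2 h3 h4 =>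
    adj_and_crossesPair_of_sees_only hS hL'.plane hD hvis hpc h1 h2 h3 h4
  -- One of `x` and `y` differs from `c`; this is where a fifth point is needed.
  have hadj : (pathGraph (a :: p :: b :: x :: y :: T)).Adj b c := by
    by_cases hxc : x = c
    · subst hxc
      exact (key y (Ne.symm hpy) (Ne.symm hay) (Ne.symm hby) (Ne.symm hxy)).1
    · exact (key x (Ne.symm hpx) (Ne.symm hax) (Ne.symm hbx) hxc).1
  have hcx : c = x := by
    rcases eq_or_eq_of_pathGraph_adj_third hL'.nodup hadj with h | h
    · exact absurd h hcp
    · exact h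
  subst hcx
  obtain rfl := hindex 3 c rfl rfl
  have hcross := (key y (Ne.symm hpy) (Ne.symm hay) (Ne.symm hby) (Ne.symm hxy)).2
  -- In the new path `b` sees `a`: `ab` is an edge of the first path, and the edges `bp` and `ac`,
  -- absent from that path, each share an end with it.
  have hM : IsPlanePathTo u (b :: p :: a :: c :: y :: T) := hj.isPlanePathTo hS hL'
  have hsee : SeesAt (b :: p :: a :: c :: y :: T) 2 := by
    refine ⟨le_rfl, b, a, rfl, rfl, fun v w hvw hcr => ?_⟩
    obtain ⟨n1, n2, n3, n4⟩ := hcr.ne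
    rw [pathGraph_adj hM.nodup] at hvw
    have hvw' : s(v, w) ∈ edgeList (p :: a :: b :: c :: y :: T) := by
      simp only [edgeList, List.mem_cons] at hvw ⊢
      rcases hvw with h | h | h | h
      · rcases Sym2.eq_iff.1 h with ⟨rfl, -⟩ | ⟨-, rfl⟩
        · exact absurd rfl n1
        · exact absurd rfl n3
      · exact Or.inl h
      · rcases Sym2.eq_iff.1 h with ⟨rfl, -⟩ | ⟨-, rfl⟩
        · exact absurd rfl n2
        · exact absurd rfl n4
      · exact Or.inr (Or.inr (Or.inr h))
    refine hL.plane.not_crossesPair (p := b) (r := a) (a := v) (b := w) ?_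
      ((pathGraph_adj hL.nodup).2 hvw') ?_ ?_ ?_ ?_ (Or.inl hcr)
    · refine SimpleGraph.Adj.symm ((pathGraph_adj hL.nodup).2 ?_)
      simp [edgeList]
    all_goals rintro rfl; contradiction
  refine ⟨rfl, hsee, ?_⟩
  -- Otherwise the same lemma, with `a` and `b` exchanged, makes `ac` cross `by`, while `bc` crosses
  -- `ay`.
  by_contra! hno
  have hvis' : ∀ r, r ≠ b → Sees (pathGraph (b :: p :: a :: c :: y :: T)) b r →
      r = p ∨ r = a ∨ r = c := by
    intro r hr hsr
    by_cases hrp : r = p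
    · exact Or.inl hrp
    · obtain ⟨i, hi, hi'⟩ := exists_seesAt_of_sees hM hr hrp hsr
      by_cases hi2 : i = 2
      · subst hi2
        exact Or.inr (Or.inl (by simpa using hi.symm))
      · obtain rfl := hno i hi' hi2
        exact Or.inr (Or.inr (by simpa using hi.symm))
  have hpc' : ¬ (pathGraph (b :: p :: a :: c :: y :: T)).Adj p c := fun h => by
    rcases eq_or_eq_of_pathGraph_adj_second hM.nodup h with h | h
    · exact hcb h
    · exact hca h
  exact hcross.false_of_swap (adj_and_crossesPair_of_sees_only hS hM.plane
    (fun r h1 h2 h3 => (hD r h1 h3 h2).symm) hvis' hpc' (Ne.symm hpy) (Ne.symm hby) (Ne.symm hay)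
    (Ne.symm hxy)).2

end

theorem mainTheorem8 (S : Finset Plane) (hcard : 5 ≤ S.card) (hS : InGeneralPosition S) (u : S)
    (C : (fixedEndpointFlipGraph S u).ConnectedComponent) : 4 < C.supp.ncard := by
  obtain ⟨P, hP⟩ := C.nonempty_supp
  obtain ⟨L₀, hL₀, rfl⟩ := IsPlanePathTo.exists_eq_toPath P
  by_cases hleaf : ∃ L, InComponent C L ∧ ∃ k, SeesAt L k ∧ ∀ j, SeesAt L j → j = k
  · obtain ⟨L, hC, k, hk, huniq⟩ := hleaf
    have hL := hC.choose
    obtain ⟨p, a, b, x, y, T, rfl⟩ := hL.exists_eq_cons hcard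
    obtain ⟨rfl, hD⟩ := eq_two_of_seesAt_unique hS hL hk huniq
    have hC' : InComponent C (a :: p :: b :: x :: y :: T) := hC.prefixReverse hS hk
    have hk' : SeesAt (a :: p :: b :: x :: y :: T) 2 := hk.symm hS hL
    obtain ⟨j, hj, hj2⟩ := exists_seesAt_prefixReverse_two hS hL hk hD
    have hL' := hC'.choose
    have hj3 : 3 ≤ j := by
      have := hj.1
      omega
    by_cases honly : ∀ i, SeesAt (a :: p :: b :: x :: y :: T) i → i = 2 ∨ i = j
    · obtain ⟨rfl, h2, i, hi, hi2, hi3⟩ :=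
        exists_seesAt_of_two_flips hS hL hD hL' hj hj2 honly
      have hC'' : InComponent C (b :: p :: a :: x :: y :: T) := hC'.prefixReverse hS hj
      -- The star is centred at `b, p, a, x, …`; its prolonged ray leads back through `a, p, b, x,
      -- …` to the path with a single flip.
      have h3 : SeesAt (b :: p :: a :: x :: y :: T) 3 := hj.symm hS hL'
      exact four_lt_ncard_of_three_seesAt hS hC'' h2 h3 hi (by decide) hi2.symm hi3.symm hk'
        (by decide)
    · push Not at honly
      obtain ⟨i, hi, hi2, hij⟩ := honly
      -- A sole flip has index 2, so the path reached by the flip `j ≥ 3` has one besides the way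
      -- back.
      obtain ⟨l, hl, hlj⟩ := exists_seesAt_ne_of_three_le hS hcard (hj.isPlanePathTo hS hL')
        (hj.symm hS hL') hj3
      exact four_lt_ncard_of_three_seesAt hS hC' hk' hj hi hj2.symm hi2.symm hij.symm hl hlj
  · push Not at hleaf
    have hC : InComponent C L₀ := ⟨hL₀, hP⟩
    obtain ⟨i, hi⟩ := exists_seesAt hS hcard hL₀
    obtain ⟨j, hj, hji⟩ := hleaf L₀ hC i hi
    obtain ⟨k, hk, hki⟩ := hleaf _ (hC.prefixReverse hS hi) i (hi.symm hS hL₀)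
    obtain ⟨l, hl, hlj⟩ := hleaf _ (hC.prefixReverse hS hj) j (hj.symm hS hL₀)
    exact four_lt_ncard_of_two_seesAt hS hC hi hj hji.symm hk hki hl hlj
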